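/- A regular octahedron with unit edges is a congruent copy in $\mathbb{R}^3$ of the convex hull of the six points $\pm\frac{1}{\sqrt2}e_i$, $i=1,2,3$. A packing is a (finite or infinite) collection $P$ of such octahedra with pairwise disjoint interiors. Its density is $$\limsup_{R\to\infty}\frac{\operatorname{vol}\big(B(0,R)\cap\bigcup_{T\in P}T\big)}{\operatorname{vol}(B(0,R))},$$ and the packing density $\phi_o$ of regular octahedra is the supremum of the densities of all packings. Let $\alpha=\frac1\pi\arctan\sqrt2$ (so that $2\pi\alpha$ is the dihedral angle of the regular octahedron), and put $$\hat\delta_{0,2}=\tfrac12-\alpha,\qquad \hat\delta_{1,2}=\kappa^3\,\hat\delta_{0,2}\ \text{ with }\ \kappa=\frac{2\left(\frac12+2\alpha-1\right)}{1+\sin(\pi\alpha)},\qquad \hat\delta_{0,3}=\tau^3\hat\rho,\quad \hat\rho=\min(1,\hat\delta_{1,2}),$$ where $\tau$ is the solution $r\in[0,1]$ of $$r^3\hat\rho=1-3\alpha-2\left(\frac{3r}{8}\sin(2\pi\alpha)+\frac{3r^2}{8\pi}\sin(4\pi\alpha)\right).$$ Put $$r_7=\frac{1}{\frac{8}{\sqrt3}\left(\frac1{0.339}+1\right)+12},\qquad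 b_o=\left(\frac{0.182}{2}\right)^{3}\cdot\frac{7\cdot 12-6\cdot 4}{2\cdot 4-1}\cdot r_7^3\cdot\frac{4\pi/3}{\sqrt2/3}\cdot\hat\delta_{0,3},\qquad \delta_o=\frac{b_o}{1+b_o}.$$ **Theorem.** $\delta_o=1.42\ldots\times10^{-12}$, that is, $1.42\times10^{-12}\le\delta_o<1.43\times10^{-12}$, and $$\phi_o\le 1-\delta_o .$$ -/

import Mathlib

open scoped ENNReal

namespace OctahedronPacking

noncomputable section

/-- Euclidean three-dimensional space. -/
abbrev E3 : Type := EuclideanSpace ℝ (Fin 3)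

/-- The regular octahedron of edge length `1` centred at the origin: the convex hull of the six
points `± (1 / √2) eᵢ`. -/
def unitOctahedron : Set E3 :=
  convexHull ℝ
    ({v | ∃ i : Fin 3, v = EuclideanSpace.single i (1 / √2)} ∪
      {v | ∃ i : Fin 3, v = -EuclideanSpace.single i (1 / √2)})

/-- `T` is a regular octahedron with unit edges: a congruent copy of `unitOctahedron`. -/
def IsUnitOctahedron (T : Set E3) : Prop :=
  ∃ g : E3 ≃ᵢ E3, T = g '' unitOctahedron

/-- A packing of unit regular octahedra: a (finite or infinite) collection of such octahedra whose
interiors are pairwise disjoint. -/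
structure IsPacking (P : Set (Set E3)) : Prop where
  octahedron : ∀ T ∈ P, IsUnitOctahedron T
  nonoverlapping : P.Pairwise fun S T => Disjoint (interior S) (interior T)

/-- The (upper) density of a collection of bodies: the upper limit, as `R → ∞`, of the fraction of
the ball of radius `R` about the origin that is covered. -/
def upperDensity (P : Set (Set E3)) : ℝ≥0∞ :=
  Filter.limsup
    (fun R : ℝ => MeasureTheory.volume (⋃₀ P ∩ Metric.ball (0 : E3) R) /
      MeasureTheory.volume (Metric.ball (0 : E3) R))
    Filter.atTop

/-- The packing density of regular octahedra: the supremum of the densities of all packings. -/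
def packingDensity : ℝ≥0∞ :=
  ⨆ (P : Set (Set E3)) (_ : IsPacking P), upperDensity P

/-- The octahedral dihedral angle `2 arctan √2`, as a fraction of `2 π`. -/
def alphaO : ℝ := Real.arctan (√2) / Real.pi

/-- The radius ratio for `c` caps and `w` wedges in the case `α w + c / 2 > 1`. -/
def kappaO (c w : ℝ) : ℝ :=
  2 * (c / 2 + w * alphaO - 1) / (c + (w - 1) * Real.sin (Real.pi * alphaO))

/-- The radius ratio for `c` caps and `w` wedges in the case `α w + c / 2 < 1`: the solution `r` in
`[0, 1]` of the displayed equation (there is at most one in the cases considered), and `1` if there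
is none. -/
def tauO (c w ρ : ℝ) : ℝ :=
  sInf (insert 1 {r : ℝ | 0 ≤ r ∧ r ≤ 1 ∧
    r ^ 3 * ρ = 1 - (alphaO * w + c / 2) -
      (3 * r / 8 * Real.sin (2 * Real.pi * alphaO) +
        3 * r ^ 2 / (8 * Real.pi) * Real.sin (4 * Real.pi * alphaO)) * (w - 1)})

/-- The bound `1 / 2 - α` for two wedges. -/
def deltaHat02 : ℝ := 1 / 2 - alphaO

/-- The bound for one cap and two wedges. -/
def deltaHat12 : ℝ := kappaO 1 2 ^ 3 * deltaHat02

/-- The minimum of the bounds for `(c - 1, w)` and `(c + 1, w - 1)` at `(c, w) = (0, 3)`, the former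
being `1` by convention since `c - 1 < 0`. -/
def rhoHat03 : ℝ := min 1 deltaHat12

/-- The bound for three wedges. -/
def deltaHat03 : ℝ := tauO 0 3 rhoHat03 ^ 3 * rhoHat03

/-- The radius `r(k)`, with `k = 7`, `γ₄ = 0.339` and `ζ = √3 / 2`, solving
`2 r (1 / γ₄ + 1) / ζ = 1 / 2 - (k - 1) r`. -/
def pearlRadius : ℝ :=
  1 / (4 / (√3 / 2) * (1 / 0.339 + 1) + 2 * (7 - 1))

/-- The factor `(γ₃ / η)³ · (k e - g s) / (2 s - 1) · r(k)³ · v_s / v_o` with `γ₃ = 0.182`, `η = 2`,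
`k = 7`, `e = 12`, `g = 6`, `s = 4`, `v_s = 4 π / 3` and `v_o = √2 / 3`. -/
def bFactor : ℝ :=
  (0.182 / 2) ^ 3 * ((7 * 12 - 6 * 4) / (2 * 4 - 1)) * pearlRadius ^ 3 *
    ((4 * Real.pi / 3) / (√2 / 3))

/-- The constant `b_o`, evaluated at the bound for three wedges. -/
def bO : ℝ := bFactor * deltaHat03

/-- The deficit `δ_o = b_o / (1 + b_o)`. -/
def deltaO : ℝ := bO / (1 + bO)

end

end OctahedronPacking

open scoped ENNReal

namespace OctahedronPacking

open Real

/-! The constant `deltaO` enters only through its numerical value: it is shown to lie in [1.42e-12,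
1.43e-12), and independently every packing is shown to miss at least the fraction 1.43e-12 of space.

The geometric cause is the dihedral angle. As a fraction of a full turn it is α = `alphaO` ≈
0.30409, so the space around a point q of an edge of T cannot be filled by wedges: three wedges with
edges through q leave 1 - 3α > 0, four do not fit because 4α > 1, and a half space fits with T alone
because 1/2 + 2α > 1, leaving 1/2 - α. These strict inequalities survive small displacements. If q
is at distance at least 0.03 from all vertices, every octahedron meeting a ball of radius 0.012
about q coincides there with a wedge (`octahedron_eq_wedge_of_vertex_free`), and a fixed fraction of
one of two concentric balls about q stays uncovered (`exists_uncovered_of_locally_wedges`).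

To make this global, n points are spread over the middle part of each of the 12 edges of each
octahedron. By volume, at most five octahedra have such an edge part close to a given point
(`card_le_five_of_edge_near`), which bounds the number of sample points near any point
(`card_samplePoint_near_le`). The bound is used twice: the 6 vertices per octahedron spoil only
about 3n of its 12n sample points, boundary effects aside, and the holes found at the remaining ones
overlap with bounded multiplicity. Hence each ball of radius 100 has an uncovered fraction of at
least 1.5e-12 (`uncovered_ball_hundred`), and averaging over its position carries this to large
balls (`mul_volume_ball_le_of_forall_ball`). -/

/-! ### Numerical value of δ_o. -/

theorem cos_two_arctan_sqrt_two : cos (2 * arctan (√2)) = -1 / 3 := by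
  rw [cos_two_mul, cos_sq_arctan]; norm_num

theorem sin_two_arctan_sqrt_two : sin (2 * arctan (√2)) = 2 / 3 * √2 := by
  rw [sin_two_mul, sin_arctan, cos_arctan, sq_sqrt (by norm_num)]
  have h : √(1 + 2 : ℝ) * √(1 + 2 : ℝ) = 3 := by rw [mul_self_sqrt] <;> norm_num
  have h0 : √(1 + 2 : ℝ) ≠ 0 := by positivity
  field_simp
  rw [sq, h]

theorem trig_add_of_sqrt_two {x y a b c d : ℝ} (hx : cos x = a) (hx' : sin x = b * √2)
    (hy : cos y = c) (hy' : sin y = d * √2) :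
    cos (x + y) = a * c - 2 * (b * d) ∧ sin (x + y) = (b * c + a * d) * √2 := by
  have h : √2 * √2 = (2 : ℝ) := mul_self_sqrt (by norm_num)
  constructor
  · rw [cos_add, hx, hx', hy, hy']; linear_combination (-(b * d)) * h
  · rw [sin_add, hx, hx', hy, hy']; ring

/-- Since 7/23 is close to α, 23 dihedral angles nearly make seven full turns. The exact sine, a
rational multiple of √2 with denominator 3 ^ 23, measures the small defect and so determines α
precisely. -/
theorem sin_twentythree_dihedral :
    sin (23 * (2 * arctan (√2))) = (-2511243778 / 94143178827) * √2 := by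
  set p := 2 * arctan (√2) with hp
  have c1 := cos_two_arctan_sqrt_two
  have s1 := sin_two_arctan_sqrt_two
  rw [← hp] at c1 s1
  obtain ⟨c2, s2⟩ := trig_add_of_sqrt_two c1 s1 c1 s1
  obtain ⟨c4, s4⟩ := trig_add_of_sqrt_two c2 s2 c2 s2
  obtain ⟨c8, s8⟩ := trig_add_of_sqrt_two c4 s4 c4 s4
  obtain ⟨c16, s16⟩ := trig_add_of_sqrt_two c8 s8 c8 s8
  obtain ⟨c3, s3⟩ := trig_add_of_sqrt_two c2 s2 c1 s1
  obtain ⟨c7, s7⟩ := trig_add_of_sqrt_two c4 s4 c3 s3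
  obtain ⟨c23, s23⟩ := trig_add_of_sqrt_two c16 s16 c7 s7
  have : 23 * p = p + p + (p + p) + (p + p + (p + p)) + (p + p + (p + p) + (p + p + (p + p))) +
    (p + p + (p + p) + (p + p + p)) := by ring
  rw [this, s23]
  norm_num

/-- Together with `two_arctan_sqrt_two_lt`, this crude bound places 14π - 23 · 2 arctan √2 between
-π and π/2, where its sine identifies it. -/
theorem lt_two_arctan_sqrt_two : 3 * π / 5 < 2 * arctan (√2) := by
  have h0 : 0 ≤ arctan (√2) := arctan_nonneg.2 (sqrt_nonneg _)
  have hlt := arctan_lt_pi_div_two (√2)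
  by_contra hcon
  push Not at hcon
  have hc := cos_le_cos_of_nonneg_of_le_pi (by linarith) (by linarith [pi_pos]) hcon
  rw [cos_two_arctan_sqrt_two] at hc
  have e : cos (3 * π / 5) = -(2 * cos (π / 5) ^ 2 - 1) := by
    rw [← cos_two_mul, ← cos_pi_sub]; congr 1; ring
  rw [e, cos_pi_div_five] at hc
  have h5 : √5 * √5 = (5 : ℝ) := mul_self_sqrt (by norm_num)
  have h5' : (0 : ℝ) ≤ √5 := sqrt_nonneg _
  nlinarith

theorem two_arctan_sqrt_two_lt : 2 * arctan (√2) < 5 * π / 8 := by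
  have h0 : 0 ≤ arctan (√2) := arctan_nonneg.2 (sqrt_nonneg _)
  have hlt := arctan_lt_pi_div_two (√2)
  by_contra hcon
  push Not at hcon
  have hc := cos_le_cos_of_nonneg_of_le_pi (by linarith [pi_pos]) (by linarith [pi_pos]) hcon
  rw [cos_two_arctan_sqrt_two] at hc
  have e : cos (5 * π / 8) = - sin (π / 8) := by
    rw [← cos_add_pi_div_two]; congr 1; ring
  rw [e, sin_pi_div_eight] at hc
  have h2 : √2 < (3 / 2 : ℝ) := by rw [sqrt_lt' (by norm_num)]; norm_num
  have h1 : (2 / 3 : ℝ) < √(2 - √2) := by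
    apply lt_sqrt_of_sq_lt; linarith
  linarith

theorem alphaO_bounds : 0.3040864 < alphaO ∧ alphaO < 0.3040870 := by
  set d := 14 * π - 23 * (2 * arctan (√2)) with hd
  have hpi := pi_gt_d6
  have hpi' := pi_lt_d6
  have h1 := lt_two_arctan_sqrt_two
  have h2 := two_arctan_sqrt_two_lt
  have hs : sin d = 2511243778 / 94143178827 * √2 := by
    have : d = -(23 * (2 * arctan (√2))) + ((7 : ℕ) : ℝ) * (2 * π) := by rw [hd]; push_cast; ring
    rw [this, sin_add_nat_mul_two_pi, sin_neg, sin_twentythree_dihedral]; ring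
  have l2 : (1.414213 : ℝ) < √2 := by apply lt_sqrt_of_sq_lt; norm_num
  have u2 : √2 < (1.414214 : ℝ) := by rw [sqrt_lt' (by norm_num)]; norm_num
  have hpos : 0 < d := by
    by_contra hcon
    push Not at hcon
    have := sin_nonpos_of_nonpos_of_neg_pi_le hcon (by linarith)
    rw [hs] at this
    linarith
  have hj := mul_le_sin hpos.le (by linarith)
  rw [hs] at hj
  -- Jordan's inequality gives a crude bound for `d`; it makes the cubic error in `hhi` small enough
  -- for the final bounds.
  have hd1 : d ≤ 0.06 := by
    have h3 : 2 / π * d ≤ 0.03773 := by linarith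
    rw [div_mul_eq_mul_div, div_le_iff₀ pi_pos] at h3
    linarith
  have hlo : sin d < d := sin_lt hpos
  have hhi := sin_gt_sub_cube hpos
  rw [hs] at hlo hhi
  have hd3 : d ^ 3 ≤ 0.06 ^ 3 := by gcongr
  have ha : alphaO = (14 * π - d) / (46 * π) := by
    rw [alphaO, hd]; field_simp; ring
  constructor
  · rw [ha, lt_div_iff₀ (by positivity)]; linarith
  · rw [ha, div_lt_iff₀ (by positivity)]; linarith

theorem pi_mul_alphaO : π * alphaO = arctan (√2) := by
  rw [alphaO]; field_simp

theorem sin_pi_mul_alphaO : sin (π * alphaO) = √2 / √3 := by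
  rw [pi_mul_alphaO, sin_arctan, sq_sqrt (by norm_num)]
  norm_num

theorem sin_two_pi_mul_alphaO : sin (2 * π * alphaO) = 2 / 3 * √2 := by
  rw [mul_assoc, pi_mul_alphaO, sin_two_arctan_sqrt_two]

theorem sin_four_pi_mul_alphaO : sin (4 * π * alphaO) = -4 / 9 * √2 := by
  have : 4 * π * alphaO = 2 * (2 * (π * alphaO)) := by ring
  rw [this, pi_mul_alphaO, sin_two_mul, sin_two_arctan_sqrt_two, cos_two_arctan_sqrt_two]; ring

theorem sqrt_two_bounds : 1.414213 < √2 ∧ √2 < 1.414214 :=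
  ⟨by apply lt_sqrt_of_sq_lt; norm_num, by rw [sqrt_lt' (by norm_num)]; norm_num⟩

theorem sqrt_three_bounds : 1.732050 < √3 ∧ √3 < 1.732051 :=
  ⟨by apply lt_sqrt_of_sq_lt; norm_num, by rw [sqrt_lt' (by norm_num)]; norm_num⟩

theorem kappaO_bounds : 0.11909 < kappaO 1 2 ∧ kappaO 1 2 < 0.11911 := by
  obtain ⟨a1, a2⟩ := alphaO_bounds
  obtain ⟨b1, b2⟩ := sqrt_two_bounds
  obtain ⟨c1, c2⟩ := sqrt_three_bounds
  rw [kappaO, sin_pi_mul_alphaO]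
  have h1 : 0.816496 < √2 / √3 := by rw [lt_div_iff₀ (by linarith)]; linarith
  have h2 : √2 / √3 < 0.816498 := by rw [div_lt_iff₀ (by linarith)]; linarith
  constructor
  · rw [lt_div_iff₀ (by linarith)]; linarith
  · rw [div_lt_iff₀ (by linarith)]; linarith

theorem deltaHat12_bounds : 0.00033088 < deltaHat12 ∧ deltaHat12 < 0.00033107 := by
  obtain ⟨a1, a2⟩ := alphaO_bounds
  obtain ⟨k1, k2⟩ := kappaO_bounds
  have h1 : (0.11909 : ℝ) ^ 3 < kappaO 1 2 ^ 3 := by gcongr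
  have h2 : kappaO 1 2 ^ 3 < (0.11911 : ℝ) ^ 3 := by gcongr
  rw [deltaHat12, deltaHat02]
  constructor <;> nlinarith

/-- As `tauO` is an infimum, the lower bound needs the absence of roots on all of [0, 0.127525],
while the upper bound needs one root, supplied by a change of sign before 0.12754. The inserted
default 1 plays no role. -/
theorem tauO_bounds : 0.12752 < tauO 0 3 rhoHat03 ∧ tauO 0 3 rhoHat03 < 0.12755 := by
  obtain ⟨a1, a2⟩ := alphaO_bounds
  obtain ⟨b1, b2⟩ := sqrt_two_bounds
  obtain ⟨d1, d2⟩ := deltaHat12_bounds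
  have hpi := pi_gt_d6
  have hpi' := pi_lt_d6
  have hr : rhoHat03 = deltaHat12 := min_eq_right (by linarith)
  rw [tauO, hr, sin_two_pi_mul_alphaO, sin_four_pi_mul_alphaO]
  set ρ := deltaHat12
  set f : ℝ → ℝ := fun r => r ^ 3 * ρ - (1 - (alphaO * 3 + 0 / 2) -
      (3 * r / 8 * (2 / 3 * √2) + 3 * r ^ 2 / (8 * π) * (-4 / 9 * √2)) * (3 - 1)) with hf
  have hfe : ∀ r, f r = r ^ 3 * ρ - (1 - 3 * alphaO) + √2 / 2 * r - √2 / π / 3 * r ^ 2 := by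
    intro r; simp only [hf]; field_simp; ring
  have hq1 : 0.450157 < √2 / π := by rw [lt_div_iff₀ pi_pos]; linarith
  have hq2 : √2 / π < 0.450159 := by rw [div_lt_iff₀ pi_pos]; linarith
  have hneg : ∀ r, 0 ≤ r → r ≤ 0.127525 → f r < 0 := by
    intro r h0 h1
    rw [hfe]
    have e1 : r ^ 3 * ρ ≤ 0.127525 ^ 3 * 0.00033107 := by gcongr
    -- The quadratic part of `f` takes a larger value at 0.127525 than at `r`; the difference is
    -- factored.
    have e2 : 0 ≤ (0.127525 - r) * (√2 / 2 - √2 / π / 3 * (0.127525 + r)) :=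
      mul_nonneg (by linarith) (by nlinarith)
    nlinarith
  have hpos : 0 < f 0.12754 := by
    rw [hfe]
    have : 0 < (0.12754 : ℝ) ^ 3 * ρ := by positivity
    nlinarith
  constructor
  · apply lt_of_lt_of_le (b := (0.127525 : ℝ)) (by norm_num)
    refine le_csInf (Set.insert_nonempty _ _) ?_
    rintro x (rfl | ⟨hx0, -, hx⟩)
    · norm_num
    · by_contra hcon
      have := hneg x hx0 (by linarith)
      simp only [hf] at this
      linarith
  · have hcont : ContinuousOn f (Set.Icc 0 0.12754) := by
      simp only [hf]; fun_prop
    obtain ⟨r, ⟨hr0, hr1⟩, hr2⟩ := intermediate_value_Icc (by norm_num) hcont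
      ⟨(hneg 0 le_rfl (by norm_num)).le, hpos.le⟩
    refine lt_of_le_of_lt (csInf_le ⟨0, ?_⟩ (Set.mem_insert_of_mem _ ⟨hr0, by linarith, ?_⟩))
      (lt_of_le_of_lt hr1 (by norm_num))
    · rintro x (rfl | hx)
      · norm_num
      · exact hx.1
    · simp only [hf] at hr2; linarith

theorem deltaHat03_bounds : 6.8610e-7 < deltaHat03 ∧ deltaHat03 < 6.8702e-7 := by
  obtain ⟨t1, t2⟩ := tauO_bounds
  obtain ⟨d1, d2⟩ := deltaHat12_bounds
  have h1 : (0.12752 : ℝ) ^ 3 < tauO 0 3 rhoHat03 ^ 3 := by gcongr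
  have h2 : tauO 0 3 rhoHat03 ^ 3 < (0.12755 : ℝ) ^ 3 := by gcongr
  have hr : rhoHat03 = deltaHat12 := min_eq_right (by linarith)
  rw [deltaHat03]
  have h3 : 0.00033088 < rhoHat03 := by rwa [hr]
  have h4 : rhoHat03 < 0.00033107 := by rwa [hr]
  constructor <;> nlinarith

theorem bFactor_bounds : 2.0744e-6 < bFactor ∧ bFactor < 2.0751e-6 := by
  obtain ⟨b1, b2⟩ := sqrt_two_bounds
  obtain ⟨c1, c2⟩ := sqrt_three_bounds
  have hpi := pi_gt_d6
  have hpi' := pi_lt_d6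
  have hr : pearlRadius = √3 / (8 * (1 / 0.339 + 1) + 12 * √3) := by
    rw [pearlRadius]; field_simp; ring
  have p1 : 0.033063 < pearlRadius := by rw [hr, lt_div_iff₀ (by positivity)]; linarith
  have p2 : pearlRadius < 0.033066 := by rw [hr, div_lt_iff₀ (by positivity)]; linarith
  have q1 : 8.88575 < (4 * π / 3) / (√2 / 3) := by rw [lt_div_iff₀ (by positivity)]; linarith
  have q2 : (4 * π / 3) / (√2 / 3) < 8.88578 := by rw [div_lt_iff₀ (by positivity)]; linarith
  have h1 : (0.033063 : ℝ) ^ 3 < pearlRadius ^ 3 := by gcongr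
  have h2 : pearlRadius ^ 3 < (0.033066 : ℝ) ^ 3 := by gcongr
  rw [bFactor]
  have h3 : (0.033063 : ℝ) ^ 3 * 8.88575 < pearlRadius ^ 3 * ((4 * π / 3) / (√2 / 3)) := by gcongr
  have h4 : pearlRadius ^ 3 * ((4 * π / 3) / (√2 / 3)) < (0.033066 : ℝ) ^ 3 * 8.88578 := by gcongr
  rw [mul_assoc]
  constructor <;> linarith

theorem deltaO_bounds : 1.42e-12 ≤ deltaO ∧ deltaO < 1.43e-12 := by
  obtain ⟨d1, d2⟩ := deltaHat03_bounds
  obtain ⟨f1, f2⟩ := bFactor_bounds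
  have h1 : (2.0744e-6 : ℝ) * 6.8610e-7 < bO := by rw [bO]; gcongr
  have h2 : bO < (2.0751e-6 : ℝ) * 6.8702e-7 := by rw [bO]; gcongr
  have h0 : 0 < bO := by linarith
  rw [deltaO]
  constructor
  · rw [le_div_iff₀ (by linarith)]; linarith
  · rw [div_lt_iff₀ (by linarith)]; linarith
end OctahedronPacking

namespace OctahedronPacking

open MeasureTheory Set Metric

/-! ### Wedges: their share of balls. -/

/-- The volume of a cylindrically symmetric piece of a ball is proportional to its angle. -/
theorem exists_volume_sector_eq (ρ : ℝ) : ∃ C : ℝ≥0∞, ∀ (S : Set (ℝ × ℝ)) (Θ : Set ℝ),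
    MeasurableSet S → MeasurableSet Θ →
    (∀ r θ : ℝ, 0 < r → θ ∈ Ioo (-Real.pi) Real.pi →
      ((r * Real.cos θ, r * Real.sin θ) ∈ S ↔ θ ∈ Θ)) →
    volume {y : E3 | ‖y‖ < ρ ∧ (y 0, y 1) ∈ S} = C * volume (Θ ∩ Ioo (-Real.pi) Real.pi) := by
  classical
  -- Length of the part of the ball on the vertical line at squared distance `t` from the axis. The
  -- condition `0 < ρ` is needed since squaring `‖y‖ < ρ` loses the sign of `ρ`.
  set h : ℝ → ℝ≥0∞ := fun t => volume {z : ℝ | z ^ 2 + t < ρ ^ 2 ∧ 0 < ρ} with hh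
  refine ⟨∫⁻ r in Ioi (0 : ℝ), ENNReal.ofReal r * h (r ^ 2), ?_⟩
  intro S Θ hS hΘ hSΘ
  set A : Set (ℝ × ℝ × ℝ) := {v | v.1 ^ 2 + (v.2.1 ^ 2 + v.2.2 ^ 2) < ρ ^ 2 ∧ 0 < ρ ∧ v.2 ∈ S}
    with hA
  have hAm : MeasurableSet A := by
    have e : A = {v : ℝ × ℝ × ℝ | v.1 ^ 2 + (v.2.1 ^ 2 + v.2.2 ^ 2) < ρ ^ 2} ∩
        ({_v | 0 < ρ} ∩ Prod.snd ⁻¹' S) := by ext v; simp [hA]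
    rw [e]
    exact (measurableSet_lt (by fun_prop) (by fun_prop)).inter
      ((MeasurableSet.const _).inter (hS.preimage measurable_snd))
  have hmp : MeasurePreserving (fun y : E3 => (y 2, (y 0, y 1))) volume volume := by
    have h1 := PiLp.volume_preserving_ofLp (Fin 3)
    have h2 := volume_preserving_piFinSuccAbove (fun _ : Fin 3 => ℝ) 2
    have h3 := (MeasurePreserving.id (volume : Measure ℝ)).prod (volume_preserving_finTwoArrow ℝ)
    exact h3.comp (h2.comp h1)
  have hpre : {y : E3 | ‖y‖ < ρ ∧ (y 0, y 1) ∈ S} = (fun y : E3 => (y 2, (y 0, y 1))) ⁻¹' A := by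
    ext y
    simp only [mem_ofPred_eq, mem_preimage, hA]
    constructor
    · rintro ⟨h1, h2⟩
      have h0 : 0 < ρ := (norm_nonneg _).trans_lt h1
      refine ⟨?_, h0, h2⟩
      have := EuclideanSpace.real_norm_sq_eq y
      rw [Fin.sum_univ_three] at this
      nlinarith [norm_nonneg y]
    · rintro ⟨h1, h0, h2⟩
      refine ⟨?_, h2⟩
      have := EuclideanSpace.real_norm_sq_eq y
      rw [Fin.sum_univ_three] at this
      exact lt_of_pow_lt_pow_left₀ 2 h0.le (by linarith)
  rw [hpre, hmp.measure_preimage hAm.nullMeasurableSet, Measure.volume_eq_prod,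
    Measure.prod_apply_symm hAm]
  have hslice : ∀ v : ℝ × ℝ, volume ((fun x : ℝ => (x, v)) ⁻¹' A) =
      S.indicator (fun v => h (v.1 ^ 2 + v.2 ^ 2)) v := by
    intro v
    by_cases hv : v ∈ S
    · simp [hA, hh, hv]
    · simp [hA, hv]
  simp_rw [hslice]
  rw [← lintegral_comp_polarCoord_symm]
  have hhm : Measurable h := by
    have : MeasurableSet {p : ℝ × ℝ | p.2 ^ 2 + p.1 < ρ ^ 2 ∧ 0 < ρ} := by
      have e : {p : ℝ × ℝ | p.2 ^ 2 + p.1 < ρ ^ 2 ∧ 0 < ρ} =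
          {p : ℝ × ℝ | p.2 ^ 2 + p.1 < ρ ^ 2} ∩ {_p | 0 < ρ} := by ext v; simp
      rw [e]
      exact (measurableSet_lt (by fun_prop) (by fun_prop)).inter (MeasurableSet.const _)
    exact measurable_measure_prodMk_left this
  -- In polar coordinates the integrand splits into a radial factor and the indicator of the angle
  -- set, so the constant does not depend on `S`.
  have : ∀ p ∈ polarCoord.target, ENNReal.ofReal p.1 •
      S.indicator (fun v => h (v.1 ^ 2 + v.2 ^ 2)) (polarCoord.symm p) =
      (ENNReal.ofReal p.1 * h (p.1 ^ 2)) * (Θ.indicator 1 p.2) := by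
    rintro ⟨r, θ⟩ hp
    simp only [polarCoord_target, mem_prod, mem_Ioi] at hp
    have e : (r * Real.cos θ) ^ 2 + (r * Real.sin θ) ^ 2 = r ^ 2 := by
      linear_combination r ^ 2 * Real.sin_sq_add_cos_sq θ
    by_cases hθ : θ ∈ Θ
    · have := (hSΘ r θ hp.1 hp.2).2 hθ
      simp [this, hθ, e]
    · have := mt (hSΘ r θ hp.1 hp.2).1 hθ
      simp [this, hθ]
  rw [setLIntegral_congr_fun polarCoord.open_target.measurableSet this, polarCoord_target,
    Measure.volume_eq_prod, ← Measure.prod_restrict,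
    lintegral_prod_mul (f := fun r => ENNReal.ofReal r * h (r ^ 2)) (g := Θ.indicator 1)]
  · rw [lintegral_indicator_one hΘ, Measure.restrict_apply hΘ]
  · fun_prop
  · exact (measurable_one.indicator hΘ).aemeasurable

theorem abs_sin_le_sqrt_two_mul_cos_iff {θ : ℝ} (hθ : θ ∈ Ioo (-Real.pi) Real.pi) :
    |Real.sin θ| ≤ √2 * Real.cos θ ↔ θ ∈ Icc (-Real.arctan (√2)) (Real.arctan (√2)) := by
  have hat := Real.arctan_lt_pi_div_two (√2)
  constructor
  · intro h
    have hc : 0 < Real.cos θ := by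
      by_contra hcon
      push Not at hcon
      have h1 : |Real.sin θ| ≤ 0 :=
        h.trans (mul_nonpos_of_nonneg_of_nonpos (Real.sqrt_nonneg _) hcon)
      have hs : Real.sin θ = 0 := abs_eq_zero.1 (le_antisymm h1 (abs_nonneg _))
      have := (Real.sin_eq_zero_iff_of_lt_of_lt hθ.1 hθ.2).1 hs
      rw [this, Real.cos_zero] at hcon
      linarith
    have h2 : θ ∈ Ioo (-(Real.pi / 2)) (Real.pi / 2) := by
      constructor
      · by_contra hcon
        push Not at hcon
        have := Real.cos_nonpos_of_pi_div_two_le_of_le (x := -θ) (by linarith) (by linarith [hθ.1, Real.pi_pos])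
        rw [Real.cos_neg] at this; linarith
      · by_contra hcon
        push Not at hcon
        have := Real.cos_nonpos_of_pi_div_two_le_of_le hcon (by linarith [hθ.2, Real.pi_pos])
        linarith
    have h3 : |Real.tan θ| ≤ √2 := by
      rw [Real.tan_eq_sin_div_cos, abs_div, abs_of_pos hc, div_le_iff₀ hc]; exact h
    rw [abs_le] at h3
    have h4 := Real.arctan_tan h2.1 h2.2
    constructor
    · rw [← Real.arctan_neg, ← h4]; exact Real.arctan_mono h3.1
    · rw [← h4]; exact Real.arctan_mono h3.2
  · rintro ⟨h1, h2⟩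
    have hc : 0 < Real.cos θ := Real.cos_pos_of_mem_Ioo ⟨by linarith, by linarith⟩
    have h4 := Real.arctan_tan (x := θ) (by linarith) (by linarith)
    have h3 : |Real.tan θ| ≤ √2 := by
      rw [abs_le]
      constructor
      · rw [← Real.arctan_strictMono.le_iff_le, Real.arctan_neg, h4]; exact h1
      · rw [← Real.arctan_strictMono.le_iff_le, h4]; exact h2
    rw [Real.tan_eq_sin_div_cos, abs_div, abs_of_pos hc, div_le_iff₀ hc] at h3
    exact h3

/-- The polar angle runs over [-arctan √2, arctan √2], that is, over the fraction 2 arctan √2 / (2π)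
of the circle. -/
theorem volume_standard_wedge_inter_ball (ρ : ℝ) :
    volume {y : E3 | ‖y‖ < ρ ∧ |y 1| ≤ √2 * y 0} =
      ENNReal.ofReal alphaO * volume (ball (0 : E3) ρ) := by
  obtain ⟨C, hC⟩ := exists_volume_sector_eq ρ
  have hat := Real.arctan_lt_pi_div_two (√2)
  have hat0 : 0 ≤ Real.arctan (√2) := Real.arctan_nonneg.2 (Real.sqrt_nonneg _)
  have hpi := Real.pi_pos
  have h1 := hC {v | |v.2| ≤ √2 * v.1} (Icc (-Real.arctan (√2)) (Real.arctan (√2)))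
    (measurableSet_le (by fun_prop) (by fun_prop)) measurableSet_Icc (by
      intro r θ hr hθ
      rw [← abs_sin_le_sqrt_two_mul_cos_iff hθ]
      simp only [mem_ofPred_eq, abs_mul, abs_of_pos hr]
      rw [show √2 * (r * Real.cos θ) = r * (√2 * Real.cos θ) by ring, mul_le_mul_iff_right₀ hr])
  have h2 := hC univ univ MeasurableSet.univ MeasurableSet.univ (by simp)
  have hb : {y : E3 | ‖y‖ < ρ ∧ (y 0, y 1) ∈ (univ : Set (ℝ × ℝ))} = ball (0 : E3) ρ := by
    ext y; simp
  rw [hb] at h2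
  have hsub : Icc (-Real.arctan (√2)) (Real.arctan (√2)) ⊆ Ioo (-Real.pi) Real.pi :=
    fun x hx => ⟨by linarith [hx.1], by linarith [hx.2]⟩
  rw [inter_eq_left.2 hsub, Real.volume_Icc] at h1
  rw [univ_inter, Real.volume_Ioo] at h2
  refine h1.trans ?_
  rw [h2, mul_left_comm, ← ENNReal.ofReal_mul (by unfold alphaO; positivity)]
  congr 2
  rw [alphaO]; field_simp

/-- The convex wedge with the dihedral angle of the octahedron whose edge passes through `c` in the
direction `b 2`. -/
def wedge (c : E3) (b : OrthonormalBasis (Fin 3) ℝ E3) : Set E3 :=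
  {x | |b.repr (x - c) 1| ≤ √2 * b.repr (x - c) 0}

/-- The edge of `wedge c b`. -/
def wedgeEdge (c : E3) (b : OrthonormalBasis (Fin 3) ℝ E3) : Set E3 :=
  {x | b.repr (x - c) 0 = 0 ∧ b.repr (x - c) 1 = 0}

theorem volume_wedge_inter_ball {c p : E3} {b : OrthonormalBasis (Fin 3) ℝ E3}
    (hp : p ∈ wedgeEdge c b) (ρ : ℝ) :
    volume (wedge c b ∩ ball p ρ) = ENNReal.ofReal alphaO * volume (ball p ρ) := by
  have e : wedge c b ∩ ball p ρ =
      (fun x => x - p) ⁻¹' (b.repr ⁻¹' {y : E3 | ‖y‖ < ρ ∧ |y 1| ≤ √2 * y 0}) := by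
    ext x
    have h : ∀ i, b.repr (x - c) i = b.repr (x - p) i + b.repr (p - c) i := by
      intro i
      rw [← PiLp.add_apply, ← map_add, sub_add_sub_cancel]
    simp only [mem_inter_iff, wedge, mem_ofPred_eq, mem_ball, dist_eq_norm, mem_preimage,
      LinearIsometryEquiv.norm_map, h, hp.1, hp.2, add_zero]
    tauto
  have hm : MeasurableSet {y : E3 | ‖y‖ < ρ ∧ |y 1| ≤ √2 * y 0} := by
    have e : {y : E3 | ‖y‖ < ρ ∧ |y 1| ≤ √2 * y 0} =
        {y : E3 | ‖y‖ < ρ} ∩ {y : E3 | |y 1| ≤ √2 * y 0} := by ext v; simp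
    rw [e]
    exact (measurableSet_lt (by fun_prop) (by fun_prop)).inter
      (measurableSet_le (by fun_prop) (by fun_prop))
  rw [e, (measurePreserving_sub_right volume p).measure_preimage
    (hm.preimage b.repr.continuous.measurable).nullMeasurableSet,
    b.measurePreserving_repr.measure_preimage hm.nullMeasurableSet,
    volume_standard_wedge_inter_ball]
  simp
theorem volume_real_ball (p : E3) {ρ : ℝ} (hρ : 0 ≤ ρ) :
    volume.real (ball p ρ) = 4 * Real.pi / 3 * ρ ^ 3 := by
  rw [measureReal_def, EuclideanSpace.volume_ball_fin_three, ENNReal.toReal_mul, ENNReal.toReal_pow,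
    ENNReal.toReal_ofReal hρ, ENNReal.toReal_ofReal (by positivity)]
  ring

theorem volume_inter_ball_ne_top (S : Set E3) (p : E3) (ρ : ℝ) : volume (S ∩ ball p ρ) ≠ ⊤ :=
  measure_ne_top_of_subset inter_subset_right measure_ball_lt_top.ne

theorem volume_real_inter_ball_mono {S S' : Set E3} {p p' : E3} {ρ ρ' : ℝ} (h : S ∩ ball p ρ ⊆ S')
    (h' : ball p ρ ⊆ ball p' ρ') :
    volume.real (S ∩ ball p ρ) ≤ volume.real (S' ∩ ball p' ρ') :=
  measureReal_mono (subset_inter h (inter_subset_right.trans h')) (volume_inter_ball_ne_top _ _ _)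

theorem alphaO_nonneg : 0 ≤ alphaO := by
  have := Real.arctan_nonneg.2 (Real.sqrt_nonneg 2)
  rw [alphaO]; positivity

theorem volume_real_wedge_inter_ball {c p : E3} {b : OrthonormalBasis (Fin 3) ℝ E3}
    (hp : p ∈ wedgeEdge c b) {ρ : ℝ} (hρ : 0 ≤ ρ) :
    volume.real (wedge c b ∩ ball p ρ) = alphaO * (4 * Real.pi / 3 * ρ ^ 3) := by
  rw [measureReal_def, volume_wedge_inter_ball hp, ENNReal.toReal_mul,
    ENNReal.toReal_ofReal alphaO_nonneg, ← measureReal_def, volume_real_ball p hρ]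

theorem repr_sub_apply (b : OrthonormalBasis (Fin 3) ℝ E3) (x y z : E3) (i : Fin 3) :
    b.repr (x - z) i = b.repr (x - y) i + b.repr (y - z) i := by
  rw [← PiLp.add_apply, ← map_add, sub_add_sub_cancel]

theorem mem_wedgeEdge_self (c : E3) (b : OrthonormalBasis (Fin 3) ℝ E3) : c ∈ wedgeEdge c b := by
  simp [wedgeEdge]

/-- The wedge with apex at the origin is closed under addition, being a convex cone. -/
theorem wedge_subset_wedge {c p : E3} {b : OrthonormalBasis (Fin 3) ℝ E3} (hp : p ∈ wedge c b) :
    wedge p b ⊆ wedge c b := by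
  intro x hx
  simp only [wedge, mem_ofPred_eq] at *
  rw [repr_sub_apply b x p c 0, repr_sub_apply b x p c 1]
  linarith [abs_add_le (b.repr (x - p) 1) (b.repr (p - c) 1)]

/-- A wedge fills at least the fraction `alphaO` of a ball centred at any of its points. -/
theorem le_volume_real_wedge_inter_ball {c p : E3} {b : OrthonormalBasis (Fin 3) ℝ E3}
    (hp : p ∈ wedge c b) {ρ : ℝ} (hρ : 0 ≤ ρ) :
    alphaO * (4 * Real.pi / 3 * ρ ^ 3) ≤ volume.real (wedge c b ∩ ball p ρ) := by
  rw [← volume_real_wedge_inter_ball (mem_wedgeEdge_self p b) hρ]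
  exact volume_real_inter_ball_mono (inter_subset_left.trans (wedge_subset_wedge hp)) subset_rfl

/-! ### Half-ball estimates by point reflection. -/

theorem preimage_pointReflection_ball (q : E3) (ρ : ℝ) :
    (fun x : E3 => (q + q) - x) ⁻¹' ball q ρ = ball q ρ := by
  ext x
  simp only [mem_preimage, mem_ball, dist_eq_norm]
  rw [← norm_neg]; congr! 2; abel

/-- A convex set fills at most half of a ball centred outside its interior. -/
theorem volume_real_convex_inter_ball_le {S : Set E3} (hS : Convex ℝ S) {q : E3}
    (hq : q ∉ interior S) {ρ : ℝ} (hρ : 0 ≤ ρ) :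
    volume.real (S ∩ ball q ρ) ≤ 1 / 2 * (4 * Real.pi / 3 * ρ ^ 3) := by
  set A := interior S ∩ ball q ρ with hA
  have hAm : MeasurableSet A := isOpen_interior.measurableSet.inter measurableSet_ball
  set σ : E3 → E3 := fun x => (q + q) - x with hσ
  have hmp : MeasurePreserving σ volume volume := Measure.measurePreserving_sub_left volume (q + q)
  have h1 : volume (S ∩ ball q ρ) ≤ volume A := by
    have : S ∩ ball q ρ ⊆ A ∪ frontier S := by
      intro x hx
      by_cases hxi : x ∈ interior S
      · exact Or.inl ⟨hxi, hx.2⟩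
      · exact Or.inr ⟨subset_closure hx.1, hxi⟩
    calc volume (S ∩ ball q ρ) ≤ volume (A ∪ frontier S) := measure_mono this
      _ ≤ volume A + volume (frontier S) := measure_union_le _ _
      _ = volume A := by rw [hS.addHaar_frontier volume, add_zero]
  -- If a point and its reflection in `q` were both interior, so would be their midpoint `q`.
  have hdisj : Disjoint A (σ ⁻¹' A) := by
    rw [Set.disjoint_left]
    intro x hx hx'
    apply hq
    have := hS.interior.midpoint_mem hx.1 hx'.1
    convert this
    rw [hσ, midpoint_eq_smul_add]
    simp only [add_sub_cancel, ← two_smul ℝ q, smul_smul]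
    norm_num
  have hsub : A ∪ σ ⁻¹' A ⊆ ball q ρ := by
    refine union_subset inter_subset_right ?_
    rw [← preimage_pointReflection_ball q ρ]
    exact preimage_mono inter_subset_right
  have h2 : volume.real A + volume.real (σ ⁻¹' A) ≤ volume.real (ball q ρ) := by
    have hf := volume_inter_ball_ne_top (interior S) q ρ
    rw [← measureReal_union hdisj (hmp.measurable hAm) hf
      (by rw [hmp.measure_preimage hAm.nullMeasurableSet]; exact hf)]
    exact measureReal_mono hsub measure_ball_lt_top.ne
  have h3 : volume.real (σ ⁻¹' A) = volume.real A := by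
    rw [measureReal_def, hmp.measure_preimage hAm.nullMeasurableSet, measureReal_def]
  have h4 : volume.real (S ∩ ball q ρ) ≤ volume.real A :=
    ENNReal.toReal_mono (volume_inter_ball_ne_top _ _ _) h1
  rw [volume_real_ball q hρ, h3] at h2
  linarith

/-- A set containing a half ball fills at least half of the ball. -/
theorem le_volume_real_of_reflection {S : Set E3} {p : E3} {ρ : ℝ} (hρ : 0 ≤ ρ)
    (h : ∀ x ∈ ball p ρ, x ∈ S ∨ (p + p) - x ∈ S) :
    1 / 2 * (4 * Real.pi / 3 * ρ ^ 3) ≤ volume.real (S ∩ ball p ρ) := by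
  set σ : E3 → E3 := fun x => (p + p) - x with hσ
  have hmp : MeasurePreserving σ volume volume := Measure.measurePreserving_sub_left volume (p + p)
  have he : MeasurableEmbedding σ := (MeasurableEquiv.subLeft (p + p)).measurableEmbedding
  have hsub : ball p ρ ⊆ (S ∩ ball p ρ) ∪ σ ⁻¹' (S ∩ ball p ρ) := by
    intro x hx
    rcases h x hx with h1 | h1
    · exact Or.inl ⟨h1, hx⟩
    · refine Or.inr ⟨h1, ?_⟩
      rw [← preimage_pointReflection_ball] at hx
      exact hx
  have hf := volume_inter_ball_ne_top S p ρ
  have h3 : volume (σ ⁻¹' (S ∩ ball p ρ)) = volume (S ∩ ball p ρ) :=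
    hmp.measure_preimage_emb he _
  have h2 : volume.real (ball p ρ) ≤ volume.real (S ∩ ball p ρ) + volume.real (S ∩ ball p ρ) := by
    calc volume.real (ball p ρ) ≤ volume.real ((S ∩ ball p ρ) ∪ σ ⁻¹' (S ∩ ball p ρ)) :=
          measureReal_mono hsub (measure_union_ne_top hf (by rw [h3]; exact hf))
      _ ≤ volume.real (S ∩ ball p ρ) + volume.real (σ ⁻¹' (S ∩ ball p ρ)) :=
          measureReal_union_le _ _
      _ = _ := by rw [measureReal_def, measureReal_def, h3]
  rw [volume_real_ball p hρ] at h2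
  linarith

theorem sq_add_sq_le_norm_sq (b : OrthonormalBasis (Fin 3) ℝ E3) (v : E3) :
    b.repr v 0 ^ 2 + b.repr v 1 ^ 2 ≤ ‖v‖ ^ 2 := by
  rw [← b.repr.norm_map v, EuclideanSpace.real_norm_sq_eq, Fin.sum_univ_three]
  linarith [sq_nonneg (b.repr v 2)]

theorem exists_mem_wedgeEdge_dist (c p : E3) (b : OrthonormalBasis (Fin 3) ℝ E3) :
    ∃ e ∈ wedgeEdge c b, dist p e ^ 2 = b.repr (p - c) 0 ^ 2 + b.repr (p - c) 1 ^ 2 := by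
  refine ⟨p - (b.repr (p - c) 0 • b 0 + b.repr (p - c) 1 • b 1), ?_, ?_⟩
  · have h : ∀ i, b.repr (p - (b.repr (p - c) 0 • b 0 + b.repr (p - c) 1 • b 1) - c) i =
        b.repr (p - c) i - (b.repr (p - c) 0 * (EuclideanSpace.single 0 (1 : ℝ) : E3) i +
          b.repr (p - c) 1 * (EuclideanSpace.single 1 (1 : ℝ) : E3) i) := by
      intro i
      rw [sub_right_comm, map_sub, map_add, map_smul, map_smul, b.repr_self, b.repr_self]
      simp
    constructor <;> rw [h] <;> simp
  · rw [dist_eq_norm, sub_sub_cancel, ← b.repr.norm_map, EuclideanSpace.real_norm_sq_eq,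
      Fin.sum_univ_three]
    rw [map_add, map_smul, map_smul, b.repr_self, b.repr_self]
    simp

/-- Away from its edge, a wedge fills at least half of a ball centred near its boundary. -/
theorem half_le_volume_real_wedge_inter_ball {c q p : E3} {b : OrthonormalBasis (Fin 3) ℝ E3}
    {d s : ℝ} (hq : q ∉ interior (wedge c b)) (hp : p ∈ wedge c b) (hpq : dist p q ≤ s)
    (hsd : s ≤ d) (hd : ∀ e ∈ wedgeEdge c b, d ≤ dist q e) :
    1 / 2 * (4 * Real.pi / 3 * (d - s) ^ 3) ≤ volume.real (wedge c b ∩ ball q d) := by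
  set f : E3 → ℝ := fun x => |b.repr (x - c) 1| - √2 * b.repr (x - c) 0 with hf
  have hfc : Continuous f := by simp only [hf]; fun_prop
  have hfq : 0 ≤ f q := by
    by_contra hcon
    push Not at hcon
    apply hq
    have ho : IsOpen {x | f x < 0} := isOpen_lt hfc continuous_const
    refine interior_maximal ?_ ho hcon
    intro x hx
    simp only [mem_ofPred_eq, hf] at hx
    simp only [wedge, mem_ofPred_eq]; linarith
  have hfp : f p ≤ 0 := by
    simp only [wedge, mem_ofPred_eq] at hp
    simp only [hf]; linarith
  -- A point of the boundary of the wedge on the segment from `p` to `q`, where the two face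
  -- inequalities are tested by the sign of `f`. The ball of radius `d - s` about it lies in the
  -- given ball and has no edge point inside.
  obtain ⟨p', hp', hfp'⟩ := (convex_segment p q).isPreconnected.intermediate_value
    (left_mem_segment ℝ p q) (right_mem_segment ℝ p q) hfc.continuousOn ⟨hfp, hfq⟩
  have hd' : dist p' q ≤ s := by
    have : segment ℝ p q ⊆ closedBall q s :=
      (convex_closedBall q s).segment_subset (by simpa using hpq)
        (by simpa using dist_nonneg.trans hpq)
    exact this hp'
  obtain ⟨e, he, hde⟩ := exists_mem_wedgeEdge_dist c p' b
  have hde' : d - s ≤ dist p' e := by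
    have := hd e he
    have := dist_triangle q p' e
    rw [dist_comm q p'] at this
    linarith
  have hρ : 0 ≤ d - s := by linarith
  have hsub : ball p' (d - s) ⊆ ball q d := ball_subset_ball' (by linarith)
  refine (le_volume_real_of_reflection (S := wedge c b) (p := p') hρ ?_).trans
    (volume_real_inter_ball_mono inter_subset_left hsub)
  -- With `p'` on the face of sign `ε`, the half of its ball on the inner side of that face lies in
  -- the wedge.
  have key : ∀ x ∈ ball p' (d - s), ∀ ε : ℝ, (ε = 1 ∨ ε = -1) →
      ε * b.repr (p' - c) 1 = √2 * b.repr (p' - c) 0 →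
      ε * b.repr (x - p') 1 ≤ √2 * b.repr (x - p') 0 → x ∈ wedge c b := by
    intro x hx ε hε h1 h2
    have hε2 : ε * ε = 1 := by rcases hε with rfl | rfl <;> norm_num
    simp only [wedge, mem_ofPred_eq]
    rw [repr_sub_apply b x p' c 0, repr_sub_apply b x p' c 1]
    have hv := sq_add_sq_le_norm_sq b (x - p')
    have hx' : ‖x - p'‖ ^ 2 ≤ (d - s) ^ 2 := by
      rw [mem_ball, dist_eq_norm] at hx
      gcongr
    have hde2 : (d - s) ^ 2 ≤ dist p' e ^ 2 := by gcongr
    rw [hde] at hde2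
    have hr2 : √2 * √2 = (2 : ℝ) := Real.mul_self_sqrt (by norm_num)
    have hr0 : 0 < √2 := by positivity
    simp only [hf] at hfp'
    have hy0 : 0 ≤ b.repr (p' - c) 0 := by
      have := abs_nonneg (b.repr (p' - c) 1)
      by_contra hcon
      push Not at hcon
      nlinarith
    generalize b.repr (p' - c) 0 = y0 at *
    generalize b.repr (p' - c) 1 = y1 at *
    generalize b.repr (x - p') 0 = v0 at *
    generalize b.repr (x - p') 1 = v1 at *
    have hy1 : y1 ^ 2 = 2 * y0 ^ 2 := by
      have : (ε * y1) * (ε * y1) = (√2 * y0) * (√2 * y0) := by rw [h1]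
      linear_combination this - y1 ^ 2 * hε2 + y0 ^ 2 * hr2
    -- The inequality of the other face. As the dihedral angle is obtuse, the point of that face
    -- nearest to `p'` is on the edge, too far to be reached. Algebraically, if it failed then `S *
    -- A ≤ 0`, so the cross term in `e1` may be dropped and `S ^ 2 ≤ 8 * y0 ^ 2`, a contradiction.
    have hlow : 0 ≤ 2 * √2 * y0 + (√2 * v0 + ε * v1) := by
      by_contra hcon
      push Not at hcon
      set S := √2 * v0 + ε * v1 with hS
      set A := √2 * v0 - ε * v1 with hAA
      have hA0 : 0 ≤ A := by linarith
      have hS0 : S < 0 := by nlinarith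
      have e1 : 3 * S ^ 2 - 2 * S * A + 3 * A ^ 2 = 8 * (v0 ^ 2 + v1 ^ 2) := by
        simp only [hS, hAA]
        linear_combination 4 * v0 ^ 2 * hr2 + 8 * v1 ^ 2 * hε2
      have e2 : 3 * S ^ 2 ≤ 8 * (3 * y0 ^ 2) := by nlinarith
      have e3 := mul_self_lt_mul_self (a := 2 * √2 * y0) (b := -S) (by positivity) (by linarith)
      have e4 : 2 * √2 * y0 * (2 * √2 * y0) = 8 * y0 ^ 2 := by
        linear_combination 4 * y0 ^ 2 * hr2
      linarith
    rcases hε with rfl | rfl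
    · rw [abs_le]; constructor <;> linarith
    · rw [abs_le]; constructor <;> linarith
  intro x hx
  have hrefl : p' + p' - x - p' = -(x - p') := by abel
  have hx2 : p' + p' - x ∈ ball p' (d - s) := by
    rw [← preimage_pointReflection_ball] at hx; exact hx
  simp only [hf] at hfp'
  rcases le_total 0 (b.repr (p' - c) 1) with h0 | h0
  · rw [abs_of_nonneg h0] at hfp'
    rcases le_total (b.repr (x - p') 1) (√2 * b.repr (x - p') 0) with h1 | h1
    · exact Or.inl (key x hx 1 (Or.inl rfl) (by linarith) (by linarith))
    · refine Or.inr (key _ hx2 1 (Or.inl rfl) (by linarith) ?_)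
      rw [hrefl, map_neg, PiLp.neg_apply, PiLp.neg_apply]; linarith
  · rw [abs_of_nonpos h0] at hfp'
    rcases le_total (-b.repr (x - p') 1) (√2 * b.repr (x - p') 0) with h1 | h1
    · exact Or.inl (key x hx (-1) (Or.inr rfl) (by linarith) (by linarith))
    · refine Or.inr (key _ hx2 (-1) (Or.inr rfl) (by linarith) ?_)
      rw [hrefl, map_neg, PiLp.neg_apply, PiLp.neg_apply]; linarith
-- The octahedron as an ℓ¹ ball and its local shape.
/-- The regular octahedron with unit edges, centre `c` and axes spanned by `b`. -/
def octahedron (c : E3) (b : OrthonormalBasis (Fin 3) ℝ E3) : Set E3 :=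
  {x | ∑ k, |b.repr (x - c) k| ≤ 1 / √2}

theorem sum_fin_three_cyclic (f : Fin 3 → ℝ) (i : Fin 3) :
    ∑ k, f k = f i + f (i + 1) + f (i + 2) := by
  rw [Fin.sum_univ_three]
  fin_cases i <;> simp <;> ring

theorem convex_setOf_sum_abs_le (a : ℝ) : Convex ℝ {x : E3 | ∑ k, |x k| ≤ a} := by
  have h : ConvexOn ℝ univ (fun x : E3 => ∑ k, |x k|) := by
    refine ⟨convex_univ, ?_⟩
    intro x _ y _ s t hs ht _
    simp only [smul_eq_mul, Finset.mul_sum, ← Finset.sum_add_distrib]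
    refine Finset.sum_le_sum fun k _ => ?_
    simp only [PiLp.add_apply, PiLp.smul_apply, smul_eq_mul]
    refine (abs_add_le _ _).trans_eq ?_
    rw [abs_mul, abs_mul, abs_of_nonneg hs, abs_of_nonneg ht]
  simpa using h.convex_le a

theorem unitOctahedron_eq : unitOctahedron = {x : E3 | ∑ k, |x k| ≤ 1 / √2} := by
  have ha : (0 : ℝ) < 1 / √2 := by positivity
  set a : ℝ := 1 / √2 with haa
  apply Subset.antisymm
  · refine convexHull_min ?_ (convex_setOf_sum_abs_le a)
    rintro x (⟨i, rfl⟩ | ⟨i, rfl⟩) <;>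
    · simp only [mem_ofPred_eq]
      rw [sum_fin_three_cyclic _ i]
      fin_cases i <;> simp [← haa, abs_of_pos ha]
  · intro x hx
    simp only [mem_ofPred_eq] at hx
    have hC := convex_convexHull ℝ ({v : E3 | ∃ i : Fin 3, v = EuclideanSpace.single i a} ∪
      {v | ∃ i : Fin 3, v = -EuclideanSpace.single i a})
    set C := convexHull ℝ ({v : E3 | ∃ i : Fin 3, v = EuclideanSpace.single i a} ∪
      {v | ∃ i : Fin 3, v = -EuclideanSpace.single i a}) with hCdef
    have hpos : ∀ i : Fin 3, (EuclideanSpace.single i a : E3) ∈ C :=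
      fun i => subset_convexHull ℝ _ (Or.inl ⟨i, rfl⟩)
    have hneg : ∀ i : Fin 3, -(EuclideanSpace.single i a : E3) ∈ C :=
      fun i => subset_convexHull ℝ _ (Or.inr ⟨i, rfl⟩)
    have h0 : (0 : E3) ∈ C := by
      have := hC.midpoint_mem (hpos 0) (hneg 0)
      rwa [midpoint_self_neg] at this
    have hz : ∀ i, ∃ z ∈ C, (|x i| / a) • z = EuclideanSpace.single i (x i) := by
      intro i
      rcases le_total 0 (x i) with h | h
      · refine ⟨_, hpos i, ?_⟩
        rw [abs_of_nonneg h]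
        ext j
        simp only [PiLp.smul_apply, smul_eq_mul, PiLp.single_apply]
        split_ifs
        · field_simp
        · simp
      · refine ⟨_, hneg i, ?_⟩
        rw [abs_of_nonpos h]
        ext j
        simp only [PiLp.smul_apply, PiLp.neg_apply, smul_eq_mul, PiLp.single_apply]
        split_ifs
        · field_simp
        · simp
    choose z hzC hz using hz
    -- A convex combination of signed vertices; the missing weight goes to the origin, indexed by
    -- `none`.
    have hsum : x = ∑ k : Option (Fin 3), (k.elim (1 - ∑ i, |x i| / a) fun i => |x i| / a) •
        (k.elim 0 z : E3) := by
      rw [Fintype.sum_option]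
      simp only [Option.elim, hz, smul_zero, zero_add]
      ext j
      fin_cases j <;> simp [Fin.sum_univ_three]
    have hle : ∑ i, |x i| / a ≤ 1 := by
      rw [← Finset.sum_div, div_le_one ha]; exact hx
    change x ∈ C
    rw [hsum]
    refine hC.sum_mem ?_ ?_ ?_
    · rintro (_ | i) _
      · simp only [Option.elim]; linarith
      · simp only [Option.elim]; positivity
    · rw [Fintype.sum_option]; simp
    · rintro (_ | i) _
      · exact h0
      · exact hzC i

/-- By Mazur–Ulam an isometry is affine; its linear part provides the axes. -/
theorem IsUnitOctahedron.exists_eq_octahedron {T : Set E3} (hT : IsUnitOctahedron T) :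
    ∃ c b, T = octahedron c b := by
  obtain ⟨g, rfl⟩ := hT
  set L := g.toRealAffineIsometryEquiv.linearIsometryEquiv with hL
  have hg : ∀ x, g x = L x + g 0 := by
    intro x
    have := g.toRealAffineIsometryEquiv.map_vadd 0 x
    simpa using this
  refine ⟨g 0, OrthonormalBasis.ofRepr L.symm, ?_⟩
  rw [unitOctahedron_eq]
  ext x
  simp only [octahedron, mem_image, mem_ofPred_eq]
  constructor
  · rintro ⟨y, hy, rfl⟩
    simpa [hg y] using hy
  · intro h
    refine ⟨L.symm (x - g 0), h, ?_⟩
    rw [hg]; simp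

section

variable {c : E3} {b : OrthonormalBasis (Fin 3) ℝ E3}

theorem isClosed_octahedron (c : E3) (b : OrthonormalBasis (Fin 3) ℝ E3) :
    IsClosed (octahedron c b) :=
  isClosed_le (by fun_prop) continuous_const

theorem convex_octahedron (c : E3) (b : OrthonormalBasis (Fin 3) ℝ E3) :
    Convex ℝ (octahedron c b) := by
  have h := (convex_setOf_sum_abs_le (1 / √2)).linear_preimage b.repr.toLinearEquiv.toLinearMap
  have h2 := h.translate_preimage_right (-c)
  refine Eq.mp (congrArg _ ?_) h2
  ext x
  symm
  change (∑ k, |b.repr (x - c) k| ≤ 1 / √2) ↔ (∑ k, |b.repr (-c + x) k| ≤ 1 / √2)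
  rw [sub_eq_neg_add]

theorem sqrt_two_facts : 0 < 1 / √2 ∧ (1 / √2) ^ 2 = 1 / 2 ∧ √2 * (1 / √2) = 1 := by
  refine ⟨by positivity, ?_, ?_⟩
  · rw [div_pow, Real.sq_sqrt (by norm_num)]; norm_num
  · field_simp

theorem norm_sq_eq_sum_repr (b : OrthonormalBasis (Fin 3) ℝ E3) (v : E3) (i : Fin 3) :
    ‖v‖ ^ 2 = b.repr v i ^ 2 + b.repr v (i + 1) ^ 2 + b.repr v (i + 2) ^ 2 := by
  rw [← b.repr.norm_map v, EuclideanSpace.real_norm_sq_eq, sum_fin_three_cyclic _ i]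

theorem abs_repr_le_norm (b : OrthonormalBasis (Fin 3) ℝ E3) (v : E3) (i : Fin 3) :
    |b.repr v i| ≤ ‖v‖ := by
  apply abs_le_of_sq_le_sq _ (norm_nonneg v)
  rw [norm_sq_eq_sum_repr b v i]
  nlinarith [sq_nonneg (b.repr v (i + 1)), sq_nonneg (b.repr v (i + 2))]

theorem dist_le_of_mem_octahedron {x : E3} (hx : x ∈ octahedron c b) : dist x c ≤ 1 / √2 := by
  simp only [octahedron, mem_ofPred_eq] at hx
  rw [sum_fin_three_cyclic _ 0] at hx
  rw [dist_eq_norm]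
  refine (pow_le_pow_iff_left₀ (norm_nonneg _) sqrt_two_facts.1.le two_ne_zero).1 ?_
  rw [norm_sq_eq_sum_repr b _ 0, ← sq_abs, ← sq_abs (b.repr (x - c) (0 + 1)),
    ← sq_abs (b.repr (x - c) (0 + 2))]
  have h0 := abs_nonneg (b.repr (x - c) 0)
  have h1 := abs_nonneg (b.repr (x - c) (0 + 1))
  have h2 := abs_nonneg (b.repr (x - c) (0 + 2))
  have := pow_le_pow_left₀ (by positivity) hx 2
  nlinarith [mul_nonneg h0 h1, mul_nonneg h0 h2, mul_nonneg h1 h2]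

theorem volume_octahedron (c : E3) (b : OrthonormalBasis (Fin 3) ℝ E3) :
    volume (octahedron c b) = ENNReal.ofReal (√2 / 3) := by
  have hs := sqrt_two_facts
  have e : octahedron c b = (fun x => x - c) ⁻¹' (b.repr ⁻¹' (WithLp.ofLp ⁻¹'
      {y : Fin 3 → ℝ | (∑ i, |y i| ^ (1 : ℝ)) ^ (1 / (1 : ℝ)) ≤ 1 / √2})) := by
    ext x; simp [octahedron]
  have hm : MeasurableSet {y : Fin 3 → ℝ | (∑ i, |y i| ^ (1 : ℝ)) ^ (1 / (1 : ℝ)) ≤ 1 / √2} := by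
    refine measurableSet_le ?_ measurable_const
    simp only [Real.rpow_one, div_one]; fun_prop
  have hm1 := hm.preimage (PiLp.volume_preserving_ofLp (Fin 3)).measurable
  rw [e, (measurePreserving_sub_right volume c).measure_preimage
    (hm1.preimage b.repr.continuous.measurable).nullMeasurableSet,
    b.measurePreserving_repr.measure_preimage hm1.nullMeasurableSet,
    (PiLp.volume_preserving_ofLp (Fin 3)).measure_preimage hm.nullMeasurableSet,
    volume_sum_rpow_le _ le_rfl, ← ENNReal.ofReal_pow hs.1.le, ← ENNReal.ofReal_mul (by positivity)]
  congr 1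
  have g2 : Real.Gamma (1 / 1 + 1) = 1 := by
    have := Real.Gamma_nat_eq_factorial 1
    norm_num at this ⊢
  have g4 : Real.Gamma (((Fintype.card (Fin 3) : ℕ) : ℝ) / 1 + 1) = 6 := by
    have := Real.Gamma_nat_eq_factorial 3
    norm_num [Nat.factorial] at this ⊢
  rw [g2, g4]
  have h3 : √2 * √2 = (2 : ℝ) := Real.mul_self_sqrt (by norm_num)
  simp only [Fintype.card_fin]
  field_simp
  nlinarith

/-- A closed convex set without interior is its own frontier and hence null, but the octahedron has
positive volume. -/
theorem interior_octahedron_nonempty (c : E3) (b : OrthonormalBasis (Fin 3) ℝ E3) :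
    (interior (octahedron c b)).Nonempty := by
  by_contra hcon
  rw [not_nonempty_iff_eq_empty] at hcon
  have h := (convex_octahedron c b).addHaar_frontier volume
  rw [(isClosed_octahedron c b).frontier_eq, hcon, sdiff_empty, volume_octahedron,
    ENNReal.ofReal_eq_zero] at h
  have : (0 : ℝ) < √2 / 3 := by positivity
  linarith

theorem octahedron_subset_closure_interior (c : E3) (b : OrthonormalBasis (Fin 3) ℝ E3) :
    octahedron c b ⊆ closure (interior (octahedron c b)) := by
  rw [(convex_octahedron c b).closure_interior_eq_closure_of_nonempty_interior
    (interior_octahedron_nonempty c b)]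
  exact subset_closure

/-- In an orthant of two coordinates, the octahedron coincides with a wedge. -/
theorem exists_wedge_eq_octahedron (c : E3) (b : OrthonormalBasis (Fin 3) ℝ E3) (i : Fin 3)
    {ε₁ ε₂ : ℝ} (h₁ : ε₁ * ε₁ = 1) (h₂ : ε₂ * ε₂ = 1) : ∃ c' b',
      (∀ x, 0 ≤ ε₁ * b.repr (x - c) (i + 1) → 0 ≤ ε₂ * b.repr (x - c) (i + 2) →
        (x ∈ octahedron c b ↔ x ∈ wedge c' b')) ∧
      (∀ x, b.repr (x - c) i = 0 →
        ε₁ * b.repr (x - c) (i + 1) + ε₂ * b.repr (x - c) (i + 2) = 1 / √2 →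
        x ∈ wedgeEdge c' b') := by
  obtain ⟨hs0, hs1, hs2⟩ := sqrt_two_facts
  set a : ℝ := 1 / √2 with ha
  have n1 : i + 1 ≠ i := by fin_cases i <;> decide
  have n2 : i + 2 ≠ i := by fin_cases i <;> decide
  have n3 : i + 1 ≠ i + 2 := by fin_cases i <;> decide
  have hb : ∀ j k, inner ℝ (b j) (b k) = if j = k then (1 : ℝ) else 0 := by
    intro j k; exact b.inner_eq_ite j k
  -- The unit inward bisector of the two faces meeting in the edge. With the edge midpoint `c + d`
  -- as origin, the octahedron inequality in this orthant reads |coordinate along `b i`| ≤ √2 ·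
  -- (coordinate along `u`).
  set u : E3 := (-(a * ε₁)) • b (i + 1) + (-(a * ε₂)) • b (i + 2) with hu
  have huu : inner ℝ u u = (1 : ℝ) := by
    simp only [hu, inner_add_left, inner_add_right, real_inner_smul_left, real_inner_smul_right,
      hb, n3, n3.symm, if_true, if_false]
    linear_combination a ^ 2 * h₁ + a ^ 2 * h₂ + 2 * hs1
  have huw : inner ℝ u (b i) = (0 : ℝ) := by
    simp [hu, inner_add_left, real_inner_smul_left, hb, n1, n2]
  obtain ⟨b', hb'⟩ : ∃ b' : OrthonormalBasis (Fin 3) ℝ E3, b' 0 = u ∧ b' 1 = b i := by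
    have hv : Orthonormal ℝ (({0, 1} : Set (Fin 3)).domRestrict ![u, b i, 0]) := by
      rw [orthonormal_iff_ite]
      rintro ⟨j, hj⟩ ⟨k, hk⟩
      have hj' : j = 0 ∨ j = 1 := by simpa using hj
      have hk' : k = 0 ∨ k = 1 := by simpa using hk
      rcases hj' with rfl | rfl <;> rcases hk' with rfl | rfl
      · simpa using huu
      · rw [if_neg (by simp)]; simpa using huw
      · rw [if_neg (by simp)]; simpa [real_inner_comm] using huw
      · simp
    obtain ⟨b', hb'⟩ := hv.exists_orthonormalBasis_extension_of_card_eq (by simp)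
    exact ⟨b', hb' 0 (by simp), hb' 1 (by simp)⟩
  have r1 : ∀ v, b'.repr v 1 = b.repr v i := by
    intro v; rw [OrthonormalBasis.repr_apply_apply, OrthonormalBasis.repr_apply_apply, hb'.2]
  have r0 : ∀ v, b'.repr v 0 = -(a * (ε₁ * b.repr v (i + 1) + ε₂ * b.repr v (i + 2))) := by
    intro v
    simp only [OrthonormalBasis.repr_apply_apply, hb'.1, hu, inner_add_left, real_inner_smul_left]
    ring
  set d : E3 := (a / 2 * ε₁) • b (i + 1) + (a / 2 * ε₂) • b (i + 2) with hd
  have d0 : b.repr d i = 0 := by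
    simp [hd, n1.symm, n2.symm]
  have d1 : b.repr d (i + 1) = a / 2 * ε₁ := by
    simp [hd, n3]
  have d2 : b.repr d (i + 2) = a / 2 * ε₂ := by
    simp [hd, n3.symm]
  have e : ∀ x k, b.repr (x - (c + d)) k = b.repr (x - c) k - b.repr d k := by
    intro x k; rw [← sub_sub, map_sub]; rfl
  have R0 : ∀ x, b'.repr (x - (c + d)) 0 =
      -(a * (ε₁ * b.repr (x - c) (i + 1) + ε₂ * b.repr (x - c) (i + 2) - a)) := by
    intro x
    rw [r0, e, e, d1, d2]
    linear_combination a ^ 2 / 2 * h₁ + a ^ 2 / 2 * h₂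
  have R1 : ∀ x, b'.repr (x - (c + d)) 1 = b.repr (x - c) i := by
    intro x; rw [r1, e, d0, sub_zero]
  refine ⟨c + d, b', ?_, ?_⟩
  · intro x hx1 hx2
    simp only [octahedron, wedge, mem_ofPred_eq, R0, R1]
    rw [sum_fin_three_cyclic _ i]
    have a1 : |b.repr (x - c) (i + 1)| = ε₁ * b.repr (x - c) (i + 1) := by
      rw [← abs_of_nonneg hx1, abs_mul, abs_eq_abs.2 (mul_self_eq_one_iff.1 h₁), abs_one, one_mul]
    have a2 : |b.repr (x - c) (i + 2)| = ε₂ * b.repr (x - c) (i + 2) := by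
      rw [← abs_of_nonneg hx2, abs_mul, abs_eq_abs.2 (mul_self_eq_one_iff.1 h₂), abs_one, one_mul]
    rw [a1, a2]
    have : √2 * -(a * (ε₁ * b.repr (x - c) (i + 1) + ε₂ * b.repr (x - c) (i + 2) - a)) =
        a - ε₁ * b.repr (x - c) (i + 1) - ε₂ * b.repr (x - c) (i + 2) := by
      linear_combination
        (a - ε₁ * b.repr (x - c) (i + 1) - ε₂ * b.repr (x - c) (i + 2)) * hs2
    rw [this]
    constructor <;> intro h <;> linarith
  · intro x hx1 hx2
    simp only [wedgeEdge, mem_ofPred_eq, R0, R1, hx1, hx2]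
    simp
end

/-- The vertex of `octahedron c b` on the axis `b i`, on the side of the sign `ε`. -/
noncomputable def octahedronVertex (c : E3) (b : OrthonormalBasis (Fin 3) ℝ E3) (i : Fin 3) (ε : ℝ) :
    E3 :=
  c + (ε * (1 / √2)) • b i

theorem abs_repr_sub_lt (c : E3) (b : OrthonormalBasis (Fin 3) ℝ E3) {x q : E3} {s : ℝ}
    (h : dist x q < s) (i : Fin 3) : |b.repr (x - c) i - b.repr (q - c) i| < s := by
  rw [repr_sub_apply b x q c i, add_sub_cancel_right]
  rw [dist_eq_norm] at h
  exact (abs_repr_le_norm b _ i).trans_lt h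

theorem exists_sign_mul_eq_abs (y : ℝ) : ∃ ε : ℝ, (ε = 1 ∨ ε = -1) ∧ ε * y = |y| := by
  rcases le_total 0 y with h | h
  · exact ⟨1, Or.inl rfl, by rw [abs_of_nonneg h, one_mul]⟩
  · exact ⟨-1, Or.inr rfl, by rw [abs_of_nonpos h]; ring⟩

theorem mul_self_of_sign {ε : ℝ} (h : ε = 1 ∨ ε = -1) : ε * ε = 1 := by
  rcases h with rfl | rfl <;> norm_num

theorem sign_mul_nonneg_of_abs_sub_lt {ε y z s : ℝ} (hε : ε = 1 ∨ ε = -1) (hy : s ≤ ε * y)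
    (h : |z - y| < s) : 0 ≤ ε * z := by
  rw [abs_lt] at h
  rcases hε with rfl | rfl <;> linarith

/-- Near a point of an edge, the octahedron is a wedge. -/
theorem octahedron_eq_wedge_near_edge {c p : E3} {b : OrthonormalBasis (Fin 3) ℝ E3} {i : Fin 3}
    {ε₁ ε₂ ρ : ℝ} (h₁ : ε₁ = 1 ∨ ε₁ = -1) (h₂ : ε₂ = 1 ∨ ε₂ = -1) (h0 : b.repr (p - c) i = 0)
    (hs : ε₁ * b.repr (p - c) (i + 1) + ε₂ * b.repr (p - c) (i + 2) = 1 / √2)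
    (hp₁ : ρ ≤ ε₁ * b.repr (p - c) (i + 1)) (hp₂ : ρ ≤ ε₂ * b.repr (p - c) (i + 2)) :
    ∃ c' b', octahedron c b ∩ ball p ρ = wedge c' b' ∩ ball p ρ ∧ p ∈ wedgeEdge c' b' := by
  obtain ⟨c', b', h, he⟩ :=
    exists_wedge_eq_octahedron c b i (mul_self_of_sign h₁) (mul_self_of_sign h₂)
  refine ⟨c', b', ?_, he p h0 hs⟩
  ext x
  simp only [mem_inter_iff, and_congr_left_iff]
  intro hx
  exact h x (sign_mul_nonneg_of_abs_sub_lt h₁ hp₁ (abs_repr_sub_lt c b hx _))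
    (sign_mul_nonneg_of_abs_sub_lt h₂ hp₂ (abs_repr_sub_lt c b hx _))

/-- Away from its vertices and its interior, an octahedron is locally a wedge. -/
theorem octahedron_eq_wedge_of_vertex_free {c q : E3} {b : OrthonormalBasis (Fin 3) ℝ E3} {r : ℝ}
    (hr : 0 < r) (hq : q ∉ interior (octahedron c b))
    (hv : ∀ i ε, (ε = 1 ∨ ε = -1) → r ≤ dist q (octahedronVertex c b i ε))
    (hne : (octahedron c b ∩ ball q (2 / 5 * r)).Nonempty) :
    ∃ c' b', octahedron c b ∩ ball q (2 / 5 * r) = wedge c' b' ∩ ball q (2 / 5 * r) ∧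
      q ∉ interior (wedge c' b') := by
  obtain ⟨hs0, hs1, hs2⟩ := sqrt_two_facts
  set a : ℝ := 1 / √2 with ha
  -- The factor 2/5 is used as 6 · (2/5) ^ 2 < 1: below, two coordinates smaller than `s` would put
  -- `q` within √6 · `s` < `r` of a vertex.
  set s : ℝ := 2 / 5 * r with hs
  have hspos : 0 < s := by positivity
  set y : Fin 3 → ℝ := fun k => b.repr (q - c) k with hy
  have hlow : a ≤ ∑ k, |y k| := by
    by_contra hcon
    push Not at hcon
    apply hq
    have ho : IsOpen {x | ∑ k, |b.repr (x - c) k| < a} :=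
      isOpen_lt (by fun_prop) continuous_const
    have hsub : {x | ∑ k, |b.repr (x - c) k| < a} ⊆ octahedron c b := by
      intro x hx
      simp only [octahedron, mem_ofPred_eq] at hx ⊢
      exact hx.le
    exact interior_maximal hsub ho hcon
  -- A displacement shorter than `s` has ℓ¹ norm at most √3 · `s`, and √3 < 7/4.
  have hup : ∑ k, |y k| ≤ a + 7 / 4 * s := by
    obtain ⟨x, hx, hxq⟩ := hne
    simp only [octahedron, mem_ofPred_eq] at hx
    have h1 : ∀ k, |y k| ≤ |b.repr (x - c) k| + |b.repr (x - q) k| := by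
      intro k
      have : y k = b.repr (x - c) k - b.repr (x - q) k := by
        rw [repr_sub_apply b x q c k, add_sub_cancel_left]
      rw [this]; exact abs_sub _ _
    have h2 : ∑ k, |b.repr (x - q) k| ≤ 7 / 4 * s := by
      rw [mem_ball, dist_eq_norm] at hxq
      have h3 : ‖x - q‖ ^ 2 ≤ s ^ 2 := by gcongr
      rw [norm_sq_eq_sum_repr b _ 0, ← sq_abs, ← sq_abs (b.repr (x - q) (0 + 1)),
        ← sq_abs (b.repr (x - q) (0 + 2))] at h3
      rw [sum_fin_three_cyclic _ 0]
      generalize |b.repr (x - q) 0| = u at *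
      generalize |b.repr (x - q) (0 + 1)| = v at *
      generalize |b.repr (x - q) (0 + 2)| = w at *
      refine abs_le_of_sq_le_sq' ?_ (by positivity) |>.2
      nlinarith [sq_nonneg (u - v), sq_nonneg (u - w), sq_nonneg (v - w)]
    calc ∑ k, |y k| ≤ ∑ k, (|b.repr (x - c) k| + |b.repr (x - q) k|) :=
          Finset.sum_le_sum fun k _ => h1 k
      _ ≤ a + 7 / 4 * s := by rw [Finset.sum_add_distrib]; linarith
  have hbig : ∀ i : Fin 3, s ≤ |y (i + 1)| ∨ s ≤ |y (i + 2)| := by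
    intro i
    by_contra! hcon
    obtain ⟨ε, hε, hεy⟩ := exists_sign_mul_eq_abs (y i)
    have hvi := hv i ε hε
    rw [sum_fin_three_cyclic _ i] at hlow hup
    have n1 : i + 1 ≠ i := by fin_cases i <;> decide
    have n2 : i + 2 ≠ i := by fin_cases i <;> decide
    have e : dist q (octahedronVertex c b i ε) ^ 2 =
        (|y i| - a) ^ 2 + |y (i + 1)| ^ 2 + |y (i + 2)| ^ 2 := by
      rw [dist_eq_norm, octahedronVertex, ← sub_sub, norm_sq_eq_sum_repr b _ i]
      simp only [map_sub (b.repr) (q - c), map_smul, b.repr_self, PiLp.sub_apply, PiLp.smul_apply,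
        PiLp.single_apply, n1, n2, if_true, if_false, smul_eq_mul, mul_zero, sub_zero, mul_one,
        sq_abs]
      change (y i - ε * a) ^ 2 + y (i + 1) ^ 2 + y (i + 2) ^ 2 = _
      rw [← hεy]
      linear_combination (a ^ 2 - y i ^ 2) * mul_self_of_sign hε
    have h1 : |y (i + 1)| ^ 2 ≤ s ^ 2 := by gcongr; exact hcon.1.le
    have h2 : |y (i + 2)| ^ 2 ≤ s ^ 2 := by gcongr; exact hcon.2.le
    have h3 : (|y i| - a) ^ 2 ≤ (2 * s) ^ 2 := by
      apply sq_le_sq'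
      · linarith
      · linarith [abs_nonneg (y (i + 1)), abs_nonneg (y (i + 2))]
    have h4 : r ^ 2 ≤ dist q (octahedronVertex c b i ε) ^ 2 := by gcongr
    rw [e] at h4
    nlinarith
  -- Two coordinates are thus at least `s` in modulus; their signs are constant on the ball, which
  -- stays in one orthant of these two coordinates.
  obtain ⟨i, hi1, hi2⟩ : ∃ i : Fin 3, s ≤ |y (i + 1)| ∧ s ≤ |y (i + 2)| := by
    have e0 : s ≤ |y 1| ∨ s ≤ |y 2| := hbig 0
    have e1 : s ≤ |y 2| ∨ s ≤ |y 0| := hbig 1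
    have e2 : s ≤ |y 0| ∨ s ≤ |y 1| := hbig 2
    by_cases c0 : s ≤ |y 0|
    · by_cases c1 : s ≤ |y 1|
      · exact ⟨2, c0, c1⟩
      · exact ⟨1, e0.resolve_left c1, c0⟩
    · exact ⟨0, e2.resolve_left c0, e1.resolve_right c0⟩
  obtain ⟨ε₁, hε₁, hy₁⟩ := exists_sign_mul_eq_abs (y (i + 1))
  obtain ⟨ε₂, hε₂, hy₂⟩ := exists_sign_mul_eq_abs (y (i + 2))
  rw [← hy₁] at hi1
  rw [← hy₂] at hi2
  obtain ⟨c', b', h, -⟩ :=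
    exists_wedge_eq_octahedron c b i (mul_self_of_sign hε₁) (mul_self_of_sign hε₂)
  have heq : octahedron c b ∩ ball q s = wedge c' b' ∩ ball q s := by
    ext x
    simp only [mem_inter_iff, and_congr_left_iff]
    intro hx
    exact h x (sign_mul_nonneg_of_abs_sub_lt hε₁ hi1 (abs_repr_sub_lt c b hx _))
      (sign_mul_nonneg_of_abs_sub_lt hε₂ hi2 (abs_repr_sub_lt c b hx _))
  refine ⟨c', b', heq, fun hcon => hq ?_⟩
  have ho : IsOpen (interior (wedge c' b') ∩ ball q s) := isOpen_interior.inter isOpen_ball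
  refine interior_maximal ?_ ho ⟨hcon, mem_ball_self hspos⟩
  intro x hx
  have : x ∈ wedge c' b' ∩ ball q s := ⟨interior_subset hx.1, hx.2⟩
  rw [← heq] at this
  exact this.1

/-- Non-overlapping convex bodies have total volume at most that of a region containing them. -/
theorem sum_volume_real_inter_le {F : Finset (Set E3)} (hc : ∀ S ∈ F, Convex ℝ S)
    (hd : (F : Set (Set E3)).Pairwise fun S T => Disjoint (interior S) (interior T)) {B : Set E3}
    (hB : MeasurableSet B) (hB' : volume B ≠ ⊤) :
    ∑ S ∈ F, volume.real (S ∩ B) ≤ volume.real B := by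
  have h1 : ∀ S ∈ F, volume.real (S ∩ B) = volume.real (interior S ∩ B) := by
    intro S hS
    refine measureReal_congr ?_
    exact (interior_ae_eq_of_null_frontier ((hc S hS).addHaar_frontier _)).symm.inter
      (Filter.EventuallyEq.refl _ _)
  rw [Finset.sum_congr rfl h1]
  have hfin : ∀ S ∈ F, volume (interior S ∩ B) ≠ ⊤ :=
    fun S _ => measure_ne_top_of_subset inter_subset_right hB'
  rw [← measureReal_biUnion_finset (s := F) (f := fun S => interior S ∩ B) ?_
    (fun S _ => isOpen_interior.measurableSet.inter hB) hfin]
  · exact measureReal_mono (iUnion₂_subset fun S _ => inter_subset_right) hB'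
  · intro S hS T hT hST
    exact (hd hS hT hST).mono inter_subset_left inter_subset_left
-- Uncovered volume near an edge point.
/-- If only three bodies meet a ball, its uncovered volume is what they leave. -/
theorem le_volume_real_diff {P : Set (Set E3)} {q : E3} {ρ : ℝ} {T S₁ S₂ : Set E3}
    (h : ∀ S ∈ P, S = T ∨ S = S₁ ∨ S = S₂ ∨ S ∩ ball q ρ = ∅) :
    volume.real (ball q ρ) - volume.real (T ∩ ball q ρ) - volume.real (S₁ ∩ ball q ρ) -
      volume.real (S₂ ∩ ball q ρ) ≤ volume.real (ball q ρ \ ⋃₀ P) := by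
  have hsub : ball q ρ ⊆ (ball q ρ \ ⋃₀ P) ∪ ((T ∩ ball q ρ) ∪ ((S₁ ∩ ball q ρ) ∪
      (S₂ ∩ ball q ρ))) := by
    intro x hx
    by_cases hxP : x ∈ ⋃₀ P
    · obtain ⟨S, hS, hxS⟩ := hxP
      rcases h S hS with rfl | rfl | rfl | he
      · exact Or.inr (Or.inl ⟨hxS, hx⟩)
      · exact Or.inr (Or.inr (Or.inl ⟨hxS, hx⟩))
      · exact Or.inr (Or.inr (Or.inr ⟨hxS, hx⟩))
      · exact absurd (show x ∈ S ∩ ball q ρ from ⟨hxS, hx⟩) (by rw [he]; exact notMem_empty x)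
    · exact Or.inl ⟨hx, hxP⟩
  have hfin : volume ((ball q ρ \ ⋃₀ P) ∪ ((T ∩ ball q ρ) ∪ ((S₁ ∩ ball q ρ) ∪
      (S₂ ∩ ball q ρ)))) ≠ ⊤ := by
    refine measure_ne_top_of_subset (s := ball q ρ) ?_ (measure_ball_lt_top (μ := volume)).ne
    exact union_subset sdiff_subset (union_subset inter_subset_right
      (union_subset inter_subset_right inter_subset_right))
  have h0 := measureReal_mono hsub hfin
  have h1 := measureReal_union_le (μ := volume) (ball q ρ \ ⋃₀ P) ((T ∩ ball q ρ) ∪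
    ((S₁ ∩ ball q ρ) ∪ (S₂ ∩ ball q ρ)))
  have h2 := measureReal_union_le (μ := volume) (T ∩ ball q ρ) ((S₁ ∩ ball q ρ) ∪ (S₂ ∩ ball q ρ))
  have h3 := measureReal_union_le (μ := volume) (S₁ ∩ ball q ρ) (S₂ ∩ ball q ρ)
  linarith

section

variable {S : Set E3} {q c : E3} {b : OrthonormalBasis (Fin 3) ℝ E3} {R d s : ℝ}

/-- A body reaching within `s` of `q` contains the wedge share of a ball of radius `d - s` inside
the ball of radius `d` about `q`. -/
theorem le_volume_real_of_reach (hS : S ∩ ball q R = wedge c b ∩ ball q R) (hdR : d ≤ R)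
    (hsd : s ≤ d) (hr : (S ∩ ball q s).Nonempty) :
    alphaO * (4 * Real.pi / 3 * (d - s) ^ 3) ≤ volume.real (S ∩ ball q d) := by
  obtain ⟨p, hpS, hpq⟩ := hr
  have hp : p ∈ wedge c b ∩ ball q R := by
    rw [← hS]; exact ⟨hpS, ball_subset_ball (hsd.trans hdR) hpq⟩
  rw [mem_ball] at hpq
  refine (le_volume_real_wedge_inter_ball hp.1 (by linarith)).trans ?_
  have hsub : ball p (d - s) ⊆ ball q d := ball_subset_ball' (by linarith)
  refine volume_real_inter_ball_mono ?_ hsub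
  intro x hx
  have : x ∈ wedge c b ∩ ball q R := ⟨hx.1, ball_subset_ball hdR (hsub hx.2)⟩
  rw [← hS] at this
  exact this.1

theorem volume_real_inter_ball_congr (hS : S ∩ ball q R = wedge c b ∩ ball q R) (hdR : d ≤ R) :
    S ∩ ball q d = wedge c b ∩ ball q d := by
  have h := congrArg (fun A => A ∩ ball q d) hS
  simpa only [inter_assoc, inter_eq_self_of_subset_right (ball_subset_ball hdR)] using h

theorem le_volume_real_of_reach_of_edge_far (hS : S ∩ ball q R = wedge c b ∩ ball q R)
    (hq : q ∉ interior (wedge c b)) (hdR : d ≤ R) (hsd : s ≤ d) (hr : (S ∩ ball q s).Nonempty)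
    (hd : ∀ e ∈ wedgeEdge c b, d ≤ dist q e) :
    1 / 2 * (4 * Real.pi / 3 * (d - s) ^ 3) ≤ volume.real (S ∩ ball q d) := by
  obtain ⟨p, hpS, hpq⟩ := hr
  have hp : p ∈ wedge c b ∩ ball q R := by
    rw [← hS]; exact ⟨hpS, ball_subset_ball (hsd.trans hdR) hpq⟩
  rw [volume_real_inter_ball_congr hS hdR]
  exact half_le_volume_real_wedge_inter_ball hq hp.1 (mem_ball.1 hpq).le hsd hd

/-- The ball about `q` lies in the ball of radius `d + t` about the edge point `e`, of which the
wedge has the exact share `alphaO`. -/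
theorem volume_real_le_of_edge_near (hS : S ∩ ball q R = wedge c b ∩ ball q R) (hdR : d ≤ R)
    (hd : 0 ≤ d) {e : E3} (he : e ∈ wedgeEdge c b) {t : ℝ} (het : dist q e ≤ t) :
    volume.real (S ∩ ball q d) ≤ alphaO * (4 * Real.pi / 3 * (d + t) ^ 3) := by
  have ht : 0 ≤ t := dist_nonneg.trans het
  rw [volume_real_inter_ball_congr hS hdR, ← volume_real_wedge_inter_ball he (by positivity)]
  exact volume_real_inter_ball_mono inter_subset_left (ball_subset_ball' (by linarith))

end

/-- With the edge of `S₁` far away, `S₁` acts almost like a half space. If both `S₁` and `S₂`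
reached the tiny ball, the larger ball would hold shares of about α, 1/2 and α, exceeding 1. So
besides `T` at most one body meets the tiny ball; being convex with `q` not interior, it takes at
most half, and 1/2 - α > 0.19 remains. -/
theorem exists_uncovered_of_two_meeting {P : Set (Set E3)} {q cT : E3}
    {bT : OrthonormalBasis (Fin 3) ℝ E3} {R : ℝ} {T S₁ S₂ : Set E3}
    (hR : 0 < R) (hc : ∀ S ∈ P, Convex ℝ S)
    (hd : P.Pairwise fun S T => Disjoint (interior S) (interior T))
    (hT : T ∈ P) (hTW : T ∩ ball q R = wedge cT bT ∩ ball q R) (hqT : q ∈ wedgeEdge cT bT)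
    {c₁ c₂ : E3} {b₁ b₂ : OrthonormalBasis (Fin 3) ℝ E3}
    (hS₁ : S₁ ∈ P) (hS₂ : S₂ ∈ P) (h1T : S₁ ≠ T) (h2T : S₂ ≠ T) (h12 : S₁ ≠ S₂)
    (hW₁ : S₁ ∩ ball q R = wedge c₁ b₁ ∩ ball q R) (hW₂ : S₂ ∩ ball q R = wedge c₂ b₂ ∩ ball q R)
    (hq₁ : q ∉ interior S₁) (hq₂ : q ∉ interior S₂) (hqW₁ : q ∉ interior (wedge c₁ b₁))
    (hfar : ∀ e ∈ wedgeEdge c₁ b₁, 0.003825 * R ≤ dist q e)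
    (hall : ∀ S ∈ P, S = T ∨ S = S₁ ∨ S = S₂ ∨ S ∩ ball q (0.003825 * R) = ∅) :
    0.19 * (4 * Real.pi / 3 * (0.000177 * R) ^ 3) ≤
      volume.real (ball q (0.000177 * R) \ ⋃₀ P) := by
  obtain ⟨a1, a2⟩ := alphaO_bounds
  have hpi := Real.pi_pos
  set d := 0.003825 * R with hdd
  set s := 0.000177 * R with hss
  have hTd := volume_real_wedge_inter_ball hqT (ρ := d) (by positivity)
  rw [← volume_real_inter_ball_congr hTW (by linarith)] at hTd
  have hTs := volume_real_wedge_inter_ball hqT (ρ := s) (by positivity)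
  rw [← volume_real_inter_ball_congr hTW (by linarith)] at hTs
  have hV := volume_real_ball q (ρ := s) (by positivity)
  have hK : 0 < 4 * Real.pi / 3 * s ^ 3 := by positivity
  have hsd : s ≤ d := by linarith
  have hfinal : ∀ S, volume.real (S ∩ ball q s) ≤ 1 / 2 * (4 * Real.pi / 3 * s ^ 3) →
      (∀ S' ∈ P, S' = T ∨ S' = S ∨ S' ∩ ball q s = ∅) →
      0.19 * (4 * Real.pi / 3 * s ^ 3) ≤ volume.real (ball q s \ ⋃₀ P) := by
    intro S hS hall'
    have := le_volume_real_diff (P := P) (q := q) (ρ := s) (T := T) (S₁ := S) (S₂ := ∅) (by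
      intro S' hS'
      rcases hall' S' hS' with h | h | h <;> simp [h])
    rw [hTs, hV, empty_inter, measureReal_empty] at this
    nlinarith
  have hempty : ∀ S : Set E3, S ∩ ball q d = ∅ → S ∩ ball q s = ∅ := by
    intro S h
    exact subset_empty_iff.1 (h ▸ inter_subset_inter_right S (ball_subset_ball hsd))
  by_cases hr1 : (S₁ ∩ ball q s).Nonempty
  · by_cases hr2 : (S₂ ∩ ball q s).Nonempty
    · exfalso
      have e1 := le_volume_real_of_reach_of_edge_far hW₁ hqW₁ (by linarith) hsd hr1 hfar
      have e2 := le_volume_real_of_reach hW₂ (d := d) (by linarith) hsd hr2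
      have hsum := sum_volume_real_inter_le (F := {T, S₁, S₂}) (B := ball q d)
        (by intro S hS
            simp only [Finset.mem_insert, Finset.mem_singleton] at hS
            rcases hS with rfl | rfl | rfl <;> exact hc _ (by assumption))
        (by refine hd.mono ?_
            intro S hS
            simp only [Finset.coe_insert, Finset.coe_singleton, mem_insert_iff,
              mem_singleton_iff] at hS
            rcases hS with rfl | rfl | rfl <;> assumption)
        measurableSet_ball measure_ball_lt_top.ne
      rw [Finset.sum_insert (by simp [h1T.symm, h2T.symm]), Finset.sum_insert (by simpa using h12),
        Finset.sum_singleton, volume_real_ball q (by positivity), hTd] at hsum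
      -- Here `s / d` = 0.000177 / 0.003825 < 0.0463 and 0.9537 ^ 3 > 0.8674; the contradiction is α
      -- + (1/2 + α) · 0.8674 > 1.
      have hds : (0.9537 * d) ^ 3 ≤ (d - s) ^ 3 := by
        gcongr; rw [hdd, hss]; linarith
      have hL : 0 < 4 * Real.pi / 3 * d ^ 3 := by positivity
      have h3 : 0.8674 * (4 * Real.pi / 3 * d ^ 3) ≤ 4 * Real.pi / 3 * (d - s) ^ 3 := by
        have : 0.8674 * (4 * Real.pi / 3 * d ^ 3) ≤ 4 * Real.pi / 3 * (0.9537 * d) ^ 3 := by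
          nlinarith
        exact this.trans (by gcongr)
      nlinarith
    · rw [not_nonempty_iff_eq_empty] at hr2
      refine hfinal S₁ (volume_real_convex_inter_ball_le (hc _ hS₁) hq₁ (by positivity)) ?_
      intro S hS
      rcases hall S hS with h | h | h | h
      · exact Or.inl h
      · exact Or.inr (Or.inl h)
      · exact Or.inr (Or.inr (h ▸ hr2))
      · exact Or.inr (Or.inr (hempty S h))
  · rw [not_nonempty_iff_eq_empty] at hr1
    refine hfinal S₂ (volume_real_convex_inter_ball_le (hc _ hS₂) hq₂ (by positivity)) ?_
    intro S hS
    rcases hall S hS with h | h | h | h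
    · exact Or.inl h
    · exact Or.inr (Or.inr (h ▸ hr1))
    · exact Or.inr (Or.inl h)
    · exact Or.inr (Or.inr (hempty S h))

/-- Around a point of an edge of one of the bodies, near which all bodies look like wedges, a
definite fraction of one of two balls is uncovered. -/
theorem exists_uncovered_of_locally_wedges {P : Set (Set E3)} {q cT : E3}
    {bT : OrthonormalBasis (Fin 3) ℝ E3} {R : ℝ} {T : Set E3}
    (hR : 0 < R) (hc : ∀ S ∈ P, Convex ℝ S)
    (hd : P.Pairwise fun S T => Disjoint (interior S) (interior T))
    (hT : T ∈ P) (hTW : T ∩ ball q R = wedge cT bT ∩ ball q R) (hqT : q ∈ wedgeEdge cT bT)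
    (hq : ∀ S ∈ P, S ≠ T → q ∉ interior S)
    (hloc : ∀ S ∈ P, S ≠ T → (S ∩ ball q R).Nonempty →
      ∃ c b, S ∩ ball q R = wedge c b ∩ ball q R ∧ q ∉ interior (wedge c b)) :
    0.0005 * (4 * Real.pi / 3 * (0.085 * R) ^ 3) ≤ volume.real (ball q (0.085 * R) \ ⋃₀ P) ∨
    0.19 * (4 * Real.pi / 3 * (0.000177 * R) ^ 3) ≤
      volume.real (ball q (0.000177 * R) \ ⋃₀ P) := by
  obtain ⟨a1, a2⟩ := alphaO_bounds
  have hpi := Real.pi_pos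
  set s := 0.085 * R with hss
  have hsR : s ≤ R := by linarith
  have hTR := volume_real_wedge_inter_ball hqT (ρ := R) hR.le
  rw [← hTW] at hTR
  have hTs := volume_real_wedge_inter_ball hqT (ρ := s) (by positivity)
  rw [← volume_real_inter_ball_congr hTW hsR] at hTs
  have hV := volume_real_ball q (ρ := s) (by positivity)
  have hK : 0 < 4 * Real.pi / 3 * s ^ 3 := by positivity
  have hreach : ∀ S : Set E3, (S ∩ ball q s).Nonempty → (S ∩ ball q R).Nonempty :=
    fun S h => h.mono (inter_subset_inter_right S (ball_subset_ball hsR))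
  have hvol : ∀ S ∈ P, S ≠ T → (S ∩ ball q s).Nonempty →
      alphaO * (4 * Real.pi / 3 * (R - s) ^ 3) ≤ volume.real (S ∩ ball q R) := by
    intro S hS hST h
    obtain ⟨c, b, hW, -⟩ := hloc S hS hST (hreach S h)
    exact le_volume_real_of_reach hW le_rfl hsR h
  have hthree : ∀ S₁ ∈ P, ∀ S₂ ∈ P, ∀ S₃ ∈ P, S₁ ≠ T → S₂ ≠ T → S₃ ≠ T → S₁ ≠ S₂ → S₁ ≠ S₃ →
      S₂ ≠ S₃ → (S₁ ∩ ball q s).Nonempty → (S₂ ∩ ball q s).Nonempty →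
      (S₃ ∩ ball q s).Nonempty → False := by
    intro S₁ hS₁ S₂ hS₂ S₃ hS₃ h1T h2T h3T h12 h13 h23 r1 r2 r3
    have hsum := sum_volume_real_inter_le (F := {T, S₁, S₂, S₃}) (B := ball q R)
      (by intro S hS
          simp only [Finset.mem_insert, Finset.mem_singleton] at hS
          rcases hS with rfl | rfl | rfl | rfl <;> exact hc _ (by assumption))
      (by refine hd.mono ?_
          intro S hS
          simp only [Finset.coe_insert, Finset.coe_singleton, mem_insert_iff,
            mem_singleton_iff] at hS
          rcases hS with rfl | rfl | rfl | rfl <;> assumption)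
      measurableSet_ball measure_ball_lt_top.ne
    rw [Finset.sum_insert (by simp [h1T.symm, h2T.symm, h3T.symm]),
      Finset.sum_insert (by simp [h12, h13]), Finset.sum_insert (by simpa using h23),
      Finset.sum_singleton, volume_real_ball q hR.le, hTR] at hsum
    have e1 := hvol S₁ hS₁ h1T r1
    have e2 := hvol S₂ hS₂ h2T r2
    have e3 := hvol S₃ hS₃ h3T r3
    have hL : 0 < 4 * Real.pi / 3 * R ^ 3 := by positivity
    -- 0.915 ^ 3, and α · (1 + 3 · 0.915 ^ 3) > 1: three further bodies do not fit.
    have h3 : 4 * Real.pi / 3 * (R - s) ^ 3 = 0.766060875 * (4 * Real.pi / 3 * R ^ 3) := by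
      rw [hss]; ring
    rw [h3] at e1 e2 e3
    nlinarith
  by_cases h2 : ∃ S₁ ∈ P, ∃ S₂ ∈ P, S₁ ≠ T ∧ S₂ ≠ T ∧ S₁ ≠ S₂ ∧ (S₁ ∩ ball q s).Nonempty ∧
      (S₂ ∩ ball q s).Nonempty
  · obtain ⟨S₁, hS₁, S₂, hS₂, h1T, h2T, h12, r1, r2⟩ := h2
    have hall : ∀ S ∈ P, S = T ∨ S = S₁ ∨ S = S₂ ∨ S ∩ ball q s = ∅ := by
      intro S hS
      by_contra! hcon
      exact hthree S₁ hS₁ S₂ hS₂ S hS h1T h2T hcon.1 h12 (Ne.symm hcon.2.1) (Ne.symm hcon.2.2.1)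
        r1 r2 hcon.2.2.2
    have hall' : ∀ S ∈ P, S = T ∨ S = S₁ ∨ S = S₂ ∨ S ∩ ball q (0.003825 * R) = ∅ := by
      intro S hS
      have hsub : S ∩ ball q (0.003825 * R) ⊆ S ∩ ball q s :=
        inter_subset_inter_right S (ball_subset_ball (by linarith))
      rcases hall S hS with h | h | h | h
      · exact Or.inl h
      · exact Or.inr (Or.inl h)
      · exact Or.inr (Or.inr (Or.inl h))
      · exact Or.inr (Or.inr (Or.inr (subset_empty_iff.1 (h ▸ hsub))))
    obtain ⟨c₁, b₁, hW₁, hqW₁⟩ := hloc S₁ hS₁ h1T (hreach _ r1)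
    obtain ⟨c₂, b₂, hW₂, hqW₂⟩ := hloc S₂ hS₂ h2T (hreach _ r2)
    by_cases hf1 : ∀ e ∈ wedgeEdge c₁ b₁, 0.003825 * R ≤ dist q e
    · exact Or.inr (exists_uncovered_of_two_meeting hR hc hd hT hTW hqT hS₁ hS₂ h1T h2T h12 hW₁ hW₂
        (hq _ hS₁ h1T) (hq _ hS₂ h2T) hqW₁ hf1 hall')
    by_cases hf2 : ∀ e ∈ wedgeEdge c₂ b₂, 0.003825 * R ≤ dist q e
    · refine Or.inr (exists_uncovered_of_two_meeting hR hc hd hT hTW hqT hS₂ hS₁ h2T h1T h12.symm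
        hW₂ hW₁ (hq _ hS₂ h2T) (hq _ hS₁ h1T) hqW₂ hf2 ?_)
      intro S hS
      rcases hall' S hS with h | h | h | h <;> simp [h]
    push Not at hf1 hf2
    obtain ⟨e₁, he₁, hde₁⟩ := hf1
    obtain ⟨e₂, he₂, hde₂⟩ := hf2
    left
    have v1 := volume_real_le_of_edge_near hW₁ hsR (by positivity) he₁ hde₁.le
    have v2 := volume_real_le_of_edge_near hW₂ hsR (by positivity) he₂ hde₂.le
    -- (1 + 0.003825 / 0.085) ^ 3 = 1.045 ^ 3, and α · (1 + 2 · 1.045 ^ 3) < 0.9995: three wedges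
    -- with edges near `q` leave a gap.
    have h3 : 4 * Real.pi / 3 * (s + 0.003825 * R) ^ 3 =
        1.141166125 * (4 * Real.pi / 3 * s ^ 3) := by
      rw [hss]; ring
    rw [h3] at v1 v2
    have := le_volume_real_diff hall
    rw [hTs, hV] at this
    nlinarith
  · left
    push Not at h2
    have hfinal : ∀ S, volume.real (S ∩ ball q s) ≤ 1 / 2 * (4 * Real.pi / 3 * s ^ 3) →
        (∀ S' ∈ P, S' = T ∨ S' = S ∨ S' ∩ ball q s = ∅) →
        0.0005 * (4 * Real.pi / 3 * s ^ 3) ≤ volume.real (ball q s \ ⋃₀ P) := by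
      intro S hS hall'
      have := le_volume_real_diff (P := P) (q := q) (ρ := s) (T := T) (S₁ := S) (S₂ := ∅) (by
        intro S' hS'
        rcases hall' S' hS' with h | h | h <;> simp [h])
      rw [hTs, hV, empty_inter, measureReal_empty] at this
      nlinarith
    by_cases h1 : ∃ S₁ ∈ P, S₁ ≠ T ∧ (S₁ ∩ ball q s).Nonempty
    · obtain ⟨S₁, hS₁, h1T, r1⟩ := h1
      refine hfinal S₁ (volume_real_convex_inter_ball_le (hc _ hS₁) (hq _ hS₁ h1T)
        (by positivity)) ?_
      intro S hS
      by_contra! hcon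
      exact hcon.2.2.ne_empty (h2 S₁ hS₁ S hS h1T hcon.1 (Ne.symm hcon.2.1) r1)
    · push Not at h1
      refine hfinal ∅ (by rw [empty_inter, measureReal_empty]; positivity) ?_
      intro S hS
      by_cases hST : S = T
      · exact Or.inl hST
      · exact Or.inr (Or.inr (h1 S hS hST))
-- Points on edges.
/-- The sign attached to a Boolean. -/
def boolSign (s : Bool) : ℝ := bif s then 1 else -1

theorem boolSign_eq (s : Bool) : boolSign s = 1 ∨ boolSign s = -1 := by
  cases s <;> simp [boolSign]

/-- The point at parameter `t` on the edge `e` of `octahedron c b`. -/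
noncomputable def edgePoint (c : E3) (b : OrthonormalBasis (Fin 3) ℝ E3)
    (e : Fin 3 × Bool × Bool) (t : ℝ) : E3 :=
  c + ((boolSign e.2.1 * (t * (1 / √2))) • b (e.1 + 1) +
    (boolSign e.2.2 * ((1 - t) * (1 / √2))) • b (e.1 + 2))

section

variable (c : E3) (b : OrthonormalBasis (Fin 3) ℝ E3) (e : Fin 3 × Bool × Bool) (t : ℝ)

theorem repr_edgePoint_zero : b.repr (edgePoint c b e t - c) e.1 = 0 := by
  obtain ⟨i, s₁, s₂⟩ := e
  have n1 : i ≠ i + 1 := by fin_cases i <;> decide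
  have n2 : i ≠ i + 2 := by fin_cases i <;> decide
  simp [edgePoint, n1, n2]

theorem repr_edgePoint_one :
    b.repr (edgePoint c b e t - c) (e.1 + 1) = boolSign e.2.1 * (t * (1 / √2)) := by
  obtain ⟨i, s₁, s₂⟩ := e
  have n1 : i + 1 ≠ i + 2 := by fin_cases i <;> decide
  simp [edgePoint, n1]

theorem repr_edgePoint_two :
    b.repr (edgePoint c b e t - c) (e.1 + 2) = boolSign e.2.2 * ((1 - t) * (1 / √2)) := by
  obtain ⟨i, s₁, s₂⟩ := e
  have n1 : i + 2 ≠ i + 1 := by fin_cases i <;> decide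
  simp [edgePoint, n1]

end

theorem one_div_sqrt_two_gt : 0.707 < 1 / √2 := by
  rw [lt_div_iff₀ (by positivity)]
  linarith [sqrt_two_bounds.2]

theorem one_div_sqrt_two_lt : 1 / √2 < 0.708 := by
  rw [div_lt_iff₀ (by positivity)]
  linarith [sqrt_two_bounds.1]

section

variable {c : E3} {b : OrthonormalBasis (Fin 3) ℝ E3} {e : Fin 3 × Bool × Bool} {t : ℝ}

/-- For `t` in [0.2, 0.8] both nonzero coordinates are at least 0.2 / √2 > 0.14 in modulus, so their
signs persist on the ball. -/
theorem octahedron_eq_wedge_near_edgePoint (h0 : 0.2 ≤ t) (h1 : t ≤ 0.8) {ρ : ℝ} (hρ : ρ ≤ 0.14) :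
    ∃ c' b', octahedron c b ∩ ball (edgePoint c b e t) ρ =
      wedge c' b' ∩ ball (edgePoint c b e t) ρ ∧ edgePoint c b e t ∈ wedgeEdge c' b' := by
  have ha := one_div_sqrt_two_gt
  have m1 := mul_self_of_sign (boolSign_eq e.2.1)
  have m2 := mul_self_of_sign (boolSign_eq e.2.2)
  have e1 : boolSign e.2.1 * (boolSign e.2.1 * (t * (1 / √2))) = t * (1 / √2) := by
    linear_combination (t * (1 / √2)) * m1
  have e2 : boolSign e.2.2 * (boolSign e.2.2 * ((1 - t) * (1 / √2))) = (1 - t) * (1 / √2) := by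
    linear_combination ((1 - t) * (1 / √2)) * m2
  refine octahedron_eq_wedge_near_edge (i := e.1) (boolSign_eq e.2.1) (boolSign_eq e.2.2)
    (repr_edgePoint_zero c b e t) ?_ ?_ ?_
  · rw [repr_edgePoint_one, repr_edgePoint_two, e1, e2]; ring
  · rw [repr_edgePoint_one, e1]; nlinarith
  · rw [repr_edgePoint_two, e2]; nlinarith

theorem edgePoint_mem (h0 : 0.2 ≤ t) (h1 : t ≤ 0.8) : edgePoint c b e t ∈ octahedron c b := by
  obtain ⟨c', b', h, he⟩ :=
    octahedron_eq_wedge_near_edgePoint (c := c) (b := b) (e := e) h0 h1 (ρ := 0.14) le_rfl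
  have : edgePoint c b e t ∈ wedge c' b' ∩ ball (edgePoint c b e t) 0.14 := by
    refine ⟨?_, mem_ball_self (by norm_num)⟩
    simp only [wedge, mem_ofPred_eq, he.1, he.2]
    simp
  rw [← h] at this
  exact this.1

/-- Points on distinct edges, away from the vertices, are far apart. -/
theorem edge_eq_of_dist_edgePoint_lt {e' : Fin 3 × Bool × Bool} {t' : ℝ} (h0 : 0.2 ≤ t)
    (h1 : t ≤ 0.8) (h0' : 0.2 ≤ t') (h1' : t' ≤ 0.8)
    (hd : dist (edgePoint c b e t) (edgePoint c b e' t') < 0.14) : e = e' := by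
  have ha := one_div_sqrt_two_gt
  have hcoord := abs_repr_sub_lt c b hd
  -- Exactly one coordinate of an edge point vanishes and the others exceed 0.14 in modulus: a
  -- different axis or sign changes some coordinate by at least 0.14.
  have key : ∀ (e : Fin 3 × Bool × Bool) (t : ℝ), 0.2 ≤ t → t ≤ 0.8 → ∀ k, k ≠ e.1 →
      0.14 ≤ |b.repr (edgePoint c b e t - c) k| := by
    intro e t h0 h1 k hk
    have hk' : k = e.1 + 1 ∨ k = e.1 + 2 := by
      have h : ∀ i k : Fin 3, k ≠ i → k = i + 1 ∨ k = i + 2 := by decide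
      exact h _ _ hk
    rcases hk' with rfl | rfl
    · rw [repr_edgePoint_one, abs_mul, abs_eq_abs.2 (boolSign_eq e.2.1), abs_one, one_mul,
        abs_of_nonneg (by positivity)]
      nlinarith
    · rw [repr_edgePoint_two, abs_mul, abs_eq_abs.2 (boolSign_eq e.2.2), abs_one, one_mul,
        abs_of_nonneg (mul_nonneg (by linarith) (by linarith))]
      nlinarith
  have hi : e.1 = e'.1 := by
    by_contra hne
    have h2 := hcoord e.1
    rw [repr_edgePoint_zero, zero_sub, abs_neg] at h2
    linarith [key e' t' h0' h1' e.1 hne]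
  have hsign : ∀ (s s' : Bool) (u u' : ℝ), 0.14 ≤ u → 0.14 ≤ u' →
      |boolSign s * u - boolSign s' * u'| < 0.14 → s = s' := by
    intro s s' u u' hu hu' h
    rw [abs_lt] at h
    cases s <;> cases s' <;> simp only [boolSign, cond_true, cond_false] at h <;>
      first | rfl | (exfalso; linarith)
  obtain ⟨i, s₁, s₂⟩ := e
  obtain ⟨i', s₁', s₂'⟩ := e'
  simp only at hi
  subst hi
  have g1 := hcoord (i + 1)
  have g2 := hcoord (i + 2)
  have r1 := repr_edgePoint_one c b (i, s₁, s₂) t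
  have r1' := repr_edgePoint_one c b (i, s₁', s₂') t'
  have r2 := repr_edgePoint_two c b (i, s₁, s₂) t
  have r2' := repr_edgePoint_two c b (i, s₁', s₂') t'
  simp only at r1 r1' r2 r2'
  rw [r1, r1'] at g1
  rw [r2, r2'] at g2
  rw [hsign s₁ s₁' _ _ (by nlinarith) (by nlinarith) g1,
    hsign s₂ s₂' _ _ (by nlinarith) (by nlinarith) g2]

/-- Edges have length 1, so `t` is arc length. -/
theorem dist_edgePoint (t' : ℝ) :
    dist (edgePoint c b e t) (edgePoint c b e t') = |t - t'| := by
  rw [dist_eq_norm, ← abs_of_nonneg (norm_nonneg _), ← sq_eq_sq_iff_abs_eq_abs,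
    norm_sq_eq_sum_repr b _ e.1]
  have h : ∀ k, b.repr (edgePoint c b e t - edgePoint c b e t') k =
      b.repr (edgePoint c b e t - c) k - b.repr (edgePoint c b e t' - c) k := by
    intro k; rw [← PiLp.sub_apply, ← map_sub, sub_sub_sub_cancel_right]
  rw [h, h, h, repr_edgePoint_zero, repr_edgePoint_zero, repr_edgePoint_one, repr_edgePoint_one,
    repr_edgePoint_two, repr_edgePoint_two]
  have m1 := mul_self_of_sign (boolSign_eq e.2.1)
  have m2 := mul_self_of_sign (boolSign_eq e.2.2)
  have hs := sqrt_two_facts.2.1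
  linear_combination (t - t') ^ 2 * (1 / √2) ^ 2 * m1 + (t - t') ^ 2 * (1 / √2) ^ 2 * m2 +
    2 * (t - t') ^ 2 * hs

end

theorem card_le_of_forall_sub_le {J : Finset ℕ} {L : ℝ} (hL : 0 ≤ L)
    (h : ∀ j ∈ J, ∀ k ∈ J, (j : ℝ) - k ≤ L) : (J.card : ℝ) ≤ L + 1 := by
  rcases J.eq_empty_or_nonempty with rfl | hne
  · simp; linarith
  · have h1 := h _ (J.max'_mem hne) _ (J.min'_mem hne)
    have h2 : J ⊆ Finset.Icc (J.min' hne) (J.max' hne) := fun j hj =>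
      Finset.mem_Icc.2 ⟨J.min'_le j hj, J.le_max' j hj⟩
    have h3 := Finset.card_le_card h2
    rw [Nat.card_Icc] at h3
    have h4 : J.card + J.min' hne ≤ J.max' hne + 1 := by
      have := J.min'_le_max' hne
      omega
    have h5 : (J.card : ℝ) + (J.min' hne : ℝ) ≤ (J.max' hne : ℝ) + 1 := by exact_mod_cast h4
    linarith

/-- A sum of measures of subsets of a set is bounded by their multiplicity. -/
theorem sum_measureReal_le_mul {ι : Type*} {s : Finset ι} {E : ι → Set E3} {A : Set E3} {m : ℝ}
    (hE : ∀ i ∈ s, MeasurableSet (E i)) (hEA : ∀ i ∈ s, E i ⊆ A) (hA : MeasurableSet A)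
    (hA' : volume A ≠ ⊤) (hm : ∀ x ∈ A, ∀ F ⊆ s, (∀ i ∈ F, x ∈ E i) → (F.card : ℝ) ≤ m) :
    ∑ i ∈ s, volume.real (E i) ≤ m * volume.real A := by
  classical
  have hfin : ∀ i ∈ s, volume (E i) ≠ ⊤ := fun i hi => measure_ne_top_of_subset (hEA i hi) hA'
  -- Volumes become integrals of indicators, whose sum at a point is the number of sets containing
  -- it.
  have h1 : ∀ i ∈ s, volume.real (E i) = ∫ x in A, (E i).indicator (fun _ => (1 : ℝ)) x := by
    intro i hi
    rw [setIntegral_indicator (hE i hi), inter_eq_right.2 (hEA i hi), setIntegral_const, smul_eq_mul,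
      mul_one]
  rw [Finset.sum_congr rfl h1, ← integral_finsetSum]
  · calc ∫ x in A, ∑ i ∈ s, (E i).indicator (fun _ => (1 : ℝ)) x
        ≤ ∫ _ in A, m := by
          refine setIntegral_mono_on ?_ ?_ hA ?_
          · refine integrable_finsetSum _ fun i hi => ?_
            exact ((integrable_indicator_iff (hE i hi)).2
              (integrableOn_const (hfin i hi))).integrableOn
          · exact integrableOn_const hA'
          · intro x hx
            refine le_trans (le_of_eq ?_)
              (hm x hx {i ∈ s | x ∈ E i} (Finset.filter_subset _ _) (by simp))
            rw [Finset.card_filter]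
            push_cast
            exact Finset.sum_congr rfl fun i _ => by simp [indicator_apply]
      _ = m * volume.real A := by rw [setIntegral_const, smul_eq_mul, mul_comm]
  · intro i hi
    exact ((integrable_indicator_iff (hE i hi)).2 (integrableOn_const (hfin i hi))).integrableOn
-- Sample points and counting.
/-- The `j`-th of `n` sample points on the edge `i.2.1` of the octahedron `i.1`, where `cen` and
`bas` give the centre and the axes of each octahedron and `i.2.2 = j`. -/
noncomputable def samplePoint (cen : Set E3 → E3) (bas : Set E3 → OrthonormalBasis (Fin 3) ℝ E3)
    (n : ℕ) (i : Set E3 × (Fin 3 × Bool × Bool) × ℕ) : E3 :=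
  edgePoint (cen i.1) (bas i.1) i.2.1 (0.2 + 0.6 * (i.2.2 / n))

theorem sampleParam_mem {n j : ℕ} (hj : j < n) :
    (0.2 : ℝ) ≤ 0.2 + 0.6 * (j / n) ∧ (0.2 : ℝ) + 0.6 * (j / n) ≤ 0.8 := by
  have h1 : (j : ℝ) / n ≤ 1 := div_le_one_of_le₀ (by exact_mod_cast hj.le) (by positivity)
  have h0 : (0 : ℝ) ≤ (j : ℝ) / n := by positivity
  constructor <;> linarith

section

variable {P : Set (Set E3)} {cen : Set E3 → E3} {bas : Set E3 → OrthonormalBasis (Fin 3) ℝ E3}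

/-- At most five octahedra of a packing have an edge passing, away from its ends, close to a given
point. -/
theorem card_le_five_of_edge_near (hP : ∀ T ∈ P, T = octahedron (cen T) (bas T))
    (hd : P.Pairwise fun S T => Disjoint (interior S) (interior T)) {F : Finset (Set E3)}
    (hF : ∀ T ∈ F, T ∈ P) {x : E3}
    (hx : ∀ T ∈ F, ∃ e t, 0.2 ≤ t ∧ t ≤ 0.8 ∧ dist x (edgePoint (cen T) (bas T) e t) < 0.03) :
    F.card ≤ 5 := by
  have hsum := sum_volume_real_inter_le (F := F)
    (fun S hS => by rw [hP S (hF S hS)]; exact convex_octahedron _ _)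
    (fun S hS T hT h => hd (hF S hS) (hF T hT) h) (B := ball x 0.17) measurableSet_ball
    measure_ball_lt_top.ne
  -- A ball of radius 0.14 about the edge point fits in the ball of radius 0.17 about `x`; six
  -- octahedra are too many since 6 · α · 0.14 ^ 3 > 0.17 ^ 3.
  have hterm : ∀ T ∈ F, alphaO * (4 * Real.pi / 3 * 0.14 ^ 3) ≤ volume.real (T ∩ ball x 0.17) := by
    intro T hT
    obtain ⟨e, t, h0, h1, hxt⟩ := hx T hT
    obtain ⟨c', b', h, he⟩ := octahedron_eq_wedge_near_edgePoint (c := cen T) (b := bas T) (e := e)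
      h0 h1 (ρ := 0.14) le_rfl
    rw [← hP T (hF T hT)] at h
    rw [← volume_real_wedge_inter_ball he (by norm_num), ← h]
    refine measureReal_mono (fun y hy => ⟨hy.1, ?_⟩) (volume_inter_ball_ne_top _ _ _)
    have := dist_triangle y (edgePoint (cen T) (bas T) e t) x
    have h2 := mem_ball.1 hy.2
    rw [dist_comm] at hxt
    rw [mem_ball]
    linarith
  have h2 := (Finset.card_nsmul_le_sum F _ _ hterm).trans hsum
  rw [volume_real_ball _ (by norm_num), nsmul_eq_mul] at h2
  have hpi := Real.pi_pos
  have ha := alphaO_bounds.1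
  by_contra hcon
  have h6 : (6 : ℝ) ≤ F.card := by exact_mod_cast Nat.lt_of_not_le hcon
  have h7 : Real.pi * (F.card * alphaO * 0.14 ^ 3) ≤ Real.pi * 0.17 ^ 3 := by linarith
  have h8 := le_of_mul_le_mul_left h7 hpi
  nlinarith

/-- The number of sample points close to a given point. -/
theorem card_samplePoint_near_le (hP : ∀ T ∈ P, T = octahedron (cen T) (bas T))
    (hd : P.Pairwise fun S T => Disjoint (interior S) (interior T)) {n : ℕ} (hn : 0 < n) {r : ℝ}
    (hr0 : 0 ≤ r) (hr : r ≤ 0.03) {x : E3} {s : Finset (Set E3 × (Fin 3 × Bool × Bool) × ℕ)}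
    (hs : ∀ i ∈ s, i.1 ∈ P ∧ i.2.2 < n ∧ dist x (samplePoint cen bas n i) < r) :
    (s.card : ℝ) ≤ 5 * (2 * r * n / 0.6 + 1) := by
  classical
  have hn' : (0 : ℝ) < n := by exact_mod_cast hn
  have hL : 0 ≤ 2 * r * n / 0.6 := by positivity
  have hfib : ∀ T ∈ s.image Prod.fst,
      (s.filter fun i => i.1 = T).card ≤ ⌊2 * r * n / 0.6 + 1⌋₊ := by
    intro T _
    set s' := s.filter fun i => i.1 = T with hs'
    have hmem : ∀ i ∈ s', i.1 = T ∧ i.2.2 < n ∧ dist x (samplePoint cen bas n i) < r := by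
      intro i hi
      rw [hs', Finset.mem_filter] at hi
      exact ⟨hi.2, (hs i hi.1).2⟩
    have hdist : ∀ i ∈ s', ∀ k ∈ s', dist (samplePoint cen bas n i) (samplePoint cen bas n k) <
        2 * r := by
      intro i hi k hk
      have h1 := (hmem i hi).2.2
      have h2 := (hmem k hk).2.2
      rw [dist_comm] at h1
      linarith [dist_triangle (samplePoint cen bas n i) x (samplePoint cen bas n k)]
    -- Sample points of one octahedron less than 2r ≤ 0.06 apart share an edge, where consecutive
    -- ones are 0.6 / `n` apart.
    have hedge : ∀ i ∈ s', ∀ k ∈ s', i.2.1 = k.2.1 := by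
      intro i hi k hk
      have h1 := hdist i hi k hk
      simp only [samplePoint, (hmem i hi).1, (hmem k hk).1] at h1
      exact edge_eq_of_dist_edgePoint_lt (sampleParam_mem (hmem i hi).2.1).1
        (sampleParam_mem (hmem i hi).2.1).2 (sampleParam_mem (hmem k hk).2.1).1
        (sampleParam_mem (hmem k hk).2.1).2 (h1.trans_le (by linarith))
    have hinj : Set.InjOn (fun i : Set E3 × (Fin 3 × Bool × Bool) × ℕ => i.2.2) s' := by
      intro i hi k hk h
      exact Prod.ext ((hmem i hi).1.trans (hmem k hk).1.symm) (Prod.ext (hedge i hi k hk) h)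
    rw [← Finset.card_image_of_injOn hinj]
    refine Nat.le_floor (card_le_of_forall_sub_le hL ?_)
    intro j hj k hk
    rw [Finset.mem_image] at hj hk
    obtain ⟨i, hi, rfl⟩ := hj
    obtain ⟨l, hl, rfl⟩ := hk
    have h1 := hdist i hi l hl
    simp only [samplePoint, (hmem i hi).1, (hmem l hl).1, hedge i hi l hl] at h1
    rw [dist_edgePoint] at h1
    have h2 := (le_abs_self _).trans_lt h1
    have h3 : 0.6 * (((i.2.2 : ℝ) - l.2.2) / n) < 2 * r := by
      have : (0.6 : ℝ) * (((i.2.2 : ℝ) - l.2.2) / n) =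
        0.2 + 0.6 * (i.2.2 / n) - (0.2 + 0.6 * (l.2.2 / n)) := by ring
      rw [this]; exact h2
    rw [le_div_iff₀ (by norm_num)]
    have h4 : ((i.2.2 : ℝ) - l.2.2) / n * n = (i.2.2 : ℝ) - l.2.2 := by field_simp
    nlinarith
  have h1 := Finset.card_le_mul_card_image s _ hfib
  have h2 : (s.image Prod.fst).card ≤ 5 := by
    refine card_le_five_of_edge_near hP hd (x := x) ?_ ?_
    · intro T hT
      obtain ⟨i, hi, rfl⟩ := Finset.mem_image.1 hT
      exact (hs i hi).1
    · intro T hT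
      obtain ⟨i, hi, rfl⟩ := Finset.mem_image.1 hT
      exact ⟨_, _, (sampleParam_mem (hs i hi).2.1).1, (sampleParam_mem (hs i hi).2.1).2,
        (hs i hi).2.2.trans_le hr⟩
  have h3 : (s.card : ℝ) ≤ (⌊2 * r * n / 0.6 + 1⌋₊ : ℝ) * ((s.image Prod.fst).card : ℝ) := by
    exact_mod_cast h1
  have h4 : (⌊2 * r * n / 0.6 + 1⌋₊ : ℝ) ≤ 2 * r * n / 0.6 + 1 := Nat.floor_le (by linarith)
  have h5 : ((s.image Prod.fst).card : ℝ) ≤ 5 := by exact_mod_cast h2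
  calc (s.card : ℝ) ≤ _ := h3
    _ ≤ (2 * r * n / 0.6 + 1) * 5 := by gcongr
    _ = _ := by ring

theorem countable_packing (hP : ∀ T ∈ P, T = octahedron (cen T) (bas T))
    (hd : P.Pairwise fun S T => Disjoint (interior S) (interior T)) : P.Countable := by
  have h : P.PairwiseDisjoint (fun S : Set E3 => interior S) := hd
  refine h.countable_of_nonempty_interior fun T hT => ?_
  rw [interior_interior, hP T hT]
  exact interior_octahedron_nonempty _ _

theorem measurableSet_sUnion_packing (hP : ∀ T ∈ P, T = octahedron (cen T) (bas T))
    (hd : P.Pairwise fun S T => Disjoint (interior S) (interior T)) : MeasurableSet (⋃₀ P) :=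
  MeasurableSet.sUnion (countable_packing hP hd) fun T hT => by
    rw [hP T hT]; exact (isClosed_octahedron _ _).measurableSet

/-- The octahedra centred in a ball number at most the ratio of the volumes of the concentric ball
with radius larger by one, and of an octahedron. -/
theorem card_mul_le_of_cen_mem_ball (hP : ∀ T ∈ P, T = octahedron (cen T) (bas T))
    (hd : P.Pairwise fun S T => Disjoint (interior S) (interior T)) {F : Finset (Set E3)} {x : E3}
    {D : ℝ} (hD : 0 ≤ D) (hF : ∀ T ∈ F, T ∈ P ∧ cen T ∈ ball x (D - 1)) :
    F.card * (√2 / 3) ≤ 4 * Real.pi / 3 * D ^ 3 := by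
  have hsum := sum_volume_real_inter_le (F := F)
    (fun S hS => by rw [hP S (hF S hS).1]; exact convex_octahedron _ _)
    (fun S hS T hT h => hd (hF S hS).1 (hF T hT).1 h) (B := ball x D) measurableSet_ball
    measure_ball_lt_top.ne
  have hterm : ∀ T ∈ F, volume.real (T ∩ ball x D) = √2 / 3 := by
    intro T hT
    have hT1 := hP T (hF T hT).1
    have hsub : T ⊆ ball x D := by
      intro y hy
      rw [hT1] at hy
      have h1 := dist_le_of_mem_octahedron hy
      have h2 := mem_ball.1 (hF T hT).2
      rw [mem_ball]
      linarith [dist_triangle y (cen T) x, one_div_sqrt_two_lt]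
    rw [inter_eq_left.2 hsub, measureReal_def, hT1, volume_octahedron,
      ENNReal.toReal_ofReal (by positivity)]
  rw [Finset.sum_congr rfl hterm, Finset.sum_const, nsmul_eq_mul, volume_real_ball _ hD] at hsum
  exact hsum

theorem finite_cen_mem_ball (hP : ∀ T ∈ P, T = octahedron (cen T) (bas T))
    (hd : P.Pairwise fun S T => Disjoint (interior S) (interior T)) (x : E3) {D : ℝ}
    (hD : 0 ≤ D) : {T | T ∈ P ∧ cen T ∈ ball x (D - 1)}.Finite := by
  by_contra hinf
  obtain ⟨F, hF, hcard⟩ := Set.Infinite.exists_subset_card_eq hinf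
    (⌊4 * Real.pi / 3 * D ^ 3 / (√2 / 3)⌋₊ + 1)
  have h1 := card_mul_le_of_cen_mem_ball hP hd hD (F := F) (x := x) fun T hT => by
    simpa only [mem_ofPred_eq] using hF hT
  rw [← le_div_iff₀ (by positivity), hcard] at h1
  push_cast at h1
  linarith [Nat.lt_floor_add_one (4 * Real.pi / 3 * D ^ 3 / (√2 / 3))]

/-- Near a point of an edge that is far from all vertices of the packing, a definite volume is
uncovered. -/
theorem one_le_uncovered_near_edgePoint (hP : ∀ T ∈ P, T = octahedron (cen T) (bas T))
    (hd : P.Pairwise fun S T => Disjoint (interior S) (interior T)) {T : Set E3} (hT : T ∈ P)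
    {e : Fin 3 × Bool × Bool} {t : ℝ} (h0 : 0.2 ≤ t) (h1 : t ≤ 0.8)
    (hv : ∀ S ∈ P, ∀ i ε, (ε = 1 ∨ ε = -1) →
      0.03 ≤ dist (edgePoint (cen T) (bas T) e t) (octahedronVertex (cen S) (bas S) i ε)) :
    1 ≤ 1 / (0.0005 * (4 * Real.pi / 3 * 0.00102 ^ 3)) *
        volume.real (ball (edgePoint (cen T) (bas T) e t) 0.00102 \ ⋃₀ P) +
      1 / (0.19 * (4 * Real.pi / 3 * 0.000002124 ^ 3)) *
        volume.real (ball (edgePoint (cen T) (bas T) e t) 0.000002124 \ ⋃₀ P) := by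
  set q := edgePoint (cen T) (bas T) e t with hq
  obtain ⟨cT, bT, hTW, hqT⟩ := octahedron_eq_wedge_near_edgePoint (c := cen T) (b := bas T) (e := e)
    h0 h1 (ρ := 2 / 5 * 0.03) (by norm_num)
  rw [← hP T hT, ← hq] at hTW
  have hqint : ∀ S ∈ P, S ≠ T → q ∉ interior S := by
    intro S hS hne hqS
    have hmem : q ∈ closure (interior T) := by
      rw [hP T hT]
      exact octahedron_subset_closure_interior _ _ (edgePoint_mem h0 h1)
    obtain ⟨y, hy1, hy2⟩ := mem_closure_iff.1 hmem _ isOpen_interior hqS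
    exact Set.disjoint_left.1 (hd hS hT hne) hy1 hy2
  have hc : ∀ S ∈ P, Convex ℝ S := fun S hS => by rw [hP S hS]; exact convex_octahedron _ _
  have key := exists_uncovered_of_locally_wedges (R := 2 / 5 * 0.03) (by norm_num) hc hd hT hTW hqT
    hqint (by
      intro S hS hne hmeet
      have hqS := hqint S hS hne
      rw [hP S hS] at hqS hmeet ⊢
      exact octahedron_eq_wedge_of_vertex_free (by norm_num) hqS (hv S hS) hmeet)
  rw [show (0.085 : ℝ) * (2 / 5 * 0.03) = 0.00102 by norm_num,
    show (0.000177 : ℝ) * (2 / 5 * 0.03) = 0.000002124 by norm_num] at key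
  have hpi := Real.pi_pos
  -- Whichever alternative holds, its own term is at least 1 and the other is nonnegative; the
  -- disjunction thus becomes a linear inequality that can be summed over sample points.
  rcases key with h | h
  · refine le_add_of_le_of_nonneg ?_ (by positivity)
    rwa [one_div, ← div_eq_inv_mul, one_le_div (by positivity)]
  · refine le_add_of_nonneg_of_le (by positivity) ?_
    rwa [one_div, ← div_eq_inv_mul, one_le_div (by positivity)]

/-- The holes near the sample points overlap with bounded multiplicity. -/
theorem sum_volume_real_hole_le (hP : ∀ T ∈ P, T = octahedron (cen T) (bas T))
    (hd : P.Pairwise fun S T => Disjoint (interior S) (interior T)) {n : ℕ} (hn : 0 < n) {r : ℝ}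
    (hr0 : 0 ≤ r) (hr : r ≤ 0.03) {x₀ : E3} {D : ℝ}
    {s : Finset (Set E3 × (Fin 3 × Bool × Bool) × ℕ)}
    (hs : ∀ i ∈ s, i.1 ∈ P ∧ i.2.2 < n ∧ cen i.1 ∈ ball x₀ (D - 3)) :
    ∑ i ∈ s, volume.real (ball (samplePoint cen bas n i) r \ ⋃₀ P) ≤
      5 * (2 * r * n / 0.6 + 1) * volume.real (ball x₀ D \ ⋃₀ P) := by
  have hU := measurableSet_sUnion_packing hP hd
  refine sum_measureReal_le_mul (fun i _ => measurableSet_ball.diff hU) ?_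
    (measurableSet_ball.diff hU) (measure_ne_top_of_subset sdiff_subset measure_ball_lt_top.ne) ?_
  · intro i hi
    refine sdiff_subset_sdiff_left (ball_subset_ball' ?_)
    obtain ⟨hiP, hin, hic⟩ := hs i hi
    have h1 := dist_le_of_mem_octahedron (edgePoint_mem (c := cen i.1) (b := bas i.1) (e := i.2.1)
      (sampleParam_mem hin).1 (sampleParam_mem hin).2)
    have h2 := dist_triangle (samplePoint cen bas n i) (cen i.1) x₀
    have h3 := mem_ball.1 hic
    simp only [samplePoint] at h2 ⊢
    linarith [one_div_sqrt_two_lt]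
  · intro x _ F hF hx
    exact card_samplePoint_near_le hP hd hn hr0 hr fun i hi =>
      ⟨(hs i (hF hi)).1, (hs i (hF hi)).2.1, mem_ball.1 (hx i hi).1⟩

/-- The octahedra centred well inside a ball cover the part of a slightly smaller ball that is
covered at all. -/
theorem volume_real_ball_le_of_cen_mem_ball (hP : ∀ T ∈ P, T = octahedron (cen T) (bas T))
    {x₀ : E3} {D : ℝ} (hD : 4 ≤ D) {F : Finset (Set E3)}
    (hF : ∀ T ∈ P, cen T ∈ ball x₀ (D - 3) → T ∈ F) (hFP : ∀ T ∈ F, T ∈ P) :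
    4 * Real.pi / 3 * (D - 4) ^ 3 ≤ volume.real (ball x₀ D \ ⋃₀ P) + F.card * (√2 / 3) := by
  have hoct : ∀ T ∈ F, volume T = ENNReal.ofReal (√2 / 3) := fun T hT => by
    rw [hP T (hFP T hT)]; exact volume_octahedron _ _
  have hfin : ∀ T ∈ F, volume T ≠ ⊤ := fun T hT => by rw [hoct T hT]; exact ENNReal.ofReal_ne_top
  have hsub : ball x₀ (D - 4) ⊆ (ball x₀ D \ ⋃₀ P) ∪ ⋃ T ∈ F, T := by
    intro y hy
    by_cases hyP : y ∈ ⋃₀ P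
    · right
      obtain ⟨T, hT, hyT⟩ := hyP
      refine mem_biUnion (hF T hT ?_) hyT
      rw [hP T hT] at hyT
      have h1 := dist_le_of_mem_octahedron hyT
      rw [dist_comm] at h1
      rw [mem_ball] at hy ⊢
      linarith [dist_triangle (cen T) y x₀, one_div_sqrt_two_lt]
    · exact Or.inl ⟨ball_subset_ball (by linarith) hy, hyP⟩
  have hfinU : volume (⋃ T ∈ F, T) ≠ ⊤ :=
    ((measure_biUnion_finset_le F id).trans_lt (ENNReal.sum_lt_top.2 fun T hT =>
      (hfin T hT).lt_top)).ne
  have hfinD : volume (ball x₀ D \ ⋃₀ P) ≠ ⊤ :=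
    measure_ne_top_of_subset sdiff_subset measure_ball_lt_top.ne
  rw [← volume_real_ball x₀ (by linarith : 0 ≤ D - 4)]
  calc volume.real (ball x₀ (D - 4))
      ≤ volume.real ((ball x₀ D \ ⋃₀ P) ∪ ⋃ T ∈ F, T) :=
        measureReal_mono hsub (measure_union_lt_top hfinD.lt_top hfinU.lt_top).ne
    _ ≤ volume.real (ball x₀ D \ ⋃₀ P) + volume.real (⋃ T ∈ F, T) := measureReal_union_le _ _
    _ ≤ volume.real (ball x₀ D \ ⋃₀ P) + ∑ T ∈ F, volume.real T := by
        gcongr; exact measureReal_biUnion_finset_le F id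
    _ = _ := by
        congr 1
        rw [Finset.sum_congr rfl fun T hT => show volume.real T = √2 / 3 by
          rw [measureReal_def, hoct T hT, ENNReal.toReal_ofReal (by positivity)], Finset.sum_const,
          nsmul_eq_mul]

/-- The number of sample points close to some vertex of the packing. -/
theorem card_samplePoint_near_vertex_le (hP : ∀ T ∈ P, T = octahedron (cen T) (bas T))
    (hd : P.Pairwise fun S T => Disjoint (interior S) (interior T)) {n : ℕ} (hn : 0 < n)
    {F : Finset (Set E3)} {s : Finset (Set E3 × (Fin 3 × Bool × Bool) × ℕ)}
    (hs : ∀ i ∈ s, i.1 ∈ P ∧ i.2.2 < n ∧ ∃ S ∈ F, ∃ k ε, (ε = 1 ∨ ε = -1) ∧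
      dist (samplePoint cen bas n i) (octahedronVertex (cen S) (bas S) k ε) < 0.03) :
    (s.card : ℝ) ≤ F.card * 6 * (5 * (2 * 0.03 * n / 0.6 + 1)) := by
  classical
  set V := F ×ˢ (Finset.univ : Finset (Fin 3 × Bool)) with hV
  set near : Set E3 × Fin 3 × Bool → Finset (Set E3 × (Fin 3 × Bool × Bool) × ℕ) := fun v =>
    s.filter fun i => dist (octahedronVertex (cen v.1) (bas v.1) v.2.1 (boolSign v.2.2))
      (samplePoint cen bas n i) < 0.03 with hnear
  have hsub : s ⊆ V.biUnion near := by
    intro i hi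
    obtain ⟨-, -, S, hS, k, ε, hε, hdist⟩ := hs i hi
    obtain ⟨σ, rfl⟩ : ∃ σ, boolSign σ = ε := by
      rcases hε with rfl | rfl
      · exact ⟨true, rfl⟩
      · exact ⟨false, rfl⟩
    rw [Finset.mem_biUnion]
    refine ⟨(S, k, σ), by simp [hV, hS], ?_⟩
    rw [hnear, Finset.mem_filter]
    exact ⟨hi, by rwa [dist_comm]⟩
  have h1 : (s.card : ℝ) ≤ ∑ v ∈ V, ((near v).card : ℝ) := by
    exact_mod_cast (Finset.card_le_card hsub).trans Finset.card_biUnion_le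
  have h2 : ∀ v ∈ V, ((near v).card : ℝ) ≤ 5 * (2 * 0.03 * n / 0.6 + 1) := fun v _ =>
    card_samplePoint_near_le hP hd hn (by norm_num) le_rfl fun i hi => by
      rw [hnear, Finset.mem_filter] at hi
      exact ⟨(hs i hi.1).1, (hs i hi.1).2.1, hi.2⟩
  refine h1.trans ((Finset.sum_le_card_nsmul V _ _ h2).trans (le_of_eq ?_))
  rw [nsmul_eq_mul, hV, Finset.card_product]
  simp

/-- Every ball of radius `100` has a definite uncovered fraction. -/
theorem uncovered_ball_hundred (hP : ∀ T ∈ P, T = octahedron (cen T) (bas T))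
    (hd : P.Pairwise fun S T => Disjoint (interior S) (interior T)) (x₀ : E3) :
    1.5e-12 * (4 * Real.pi / 3 * 100 ^ 3) ≤ volume.real (ball x₀ 100 \ ⋃₀ P) := by
  classical
  set u := volume.real (ball x₀ 100 \ ⋃₀ P) with hu
  have hfin := finite_cen_mem_ball hP hd x₀ (D := 100) (by norm_num)
  set Fo := hfin.toFinset with hFo
  have hmo : ∀ T, T ∈ Fo ↔ T ∈ P ∧ cen T ∈ ball x₀ (100 - 1) := by
    intro T; rw [hFo, Set.Finite.mem_toFinset, mem_ofPred_eq]
  set Fi := Fo.filter fun T => cen T ∈ ball x₀ (100 - 3) with hFi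
  have hmi : ∀ T, T ∈ Fi ↔ T ∈ P ∧ cen T ∈ ball x₀ (100 - 3) := by
    intro T
    rw [hFi, Finset.mem_filter, hmo]
    exact ⟨fun h => ⟨h.1.1, h.2⟩, fun h => ⟨⟨h.1, ball_subset_ball (by norm_num) h.2⟩, h.2⟩⟩
  have hNo := card_mul_le_of_cen_mem_ball hP hd (by norm_num) fun T hT => (hmo T).1 hT
  have hNi := volume_real_ball_le_of_cen_mem_ball hP (x₀ := x₀) (D := 100) (by norm_num) (F := Fi)
    (fun T hT hc => (hmi T).2 ⟨hT, hc⟩) (fun T hT => ((hmi T).1 hT).1)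
  rw [← hu] at hNi
  -- So large that the `+ 1` in the multiplicity bounds is negligible even for the holes of radius
  -- 2.124e-6.
  obtain ⟨n, hnpos, hnr⟩ : ∃ n : ℕ, 0 < n ∧ (n : ℝ) = 10 ^ 8 := ⟨10 ^ 8, by norm_num, by norm_num⟩
  set I := Fi ×ˢ ((Finset.univ : Finset (Fin 3 × Bool × Bool)) ×ˢ Finset.range n) with hI
  have hmI : ∀ i ∈ I, i.1 ∈ P ∧ i.2.2 < n ∧ cen i.1 ∈ ball x₀ (100 - 3) := by
    intro i hi
    rw [hI, Finset.mem_product, Finset.mem_product, Finset.mem_range] at hi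
    exact ⟨((hmi _).1 hi.1).1, hi.2.2, ((hmi _).1 hi.1).2⟩
  have hcardI : (I.card : ℝ) = Fi.card * (12 * n) := by
    rw [hI, Finset.card_product, Finset.card_product, Finset.card_range]
    have : (Finset.univ : Finset (Fin 3 × Bool × Bool)).card = 12 := by decide
    rw [this]
    push_cast
    ring
  set bad : Set E3 × (Fin 3 × Bool × Bool) × ℕ → Prop := fun i => ∃ S ∈ P, ∃ k ε,
    (ε = 1 ∨ ε = -1) ∧
      dist (samplePoint cen bas n i) (octahedronVertex (cen S) (bas S) k ε) < 0.03 with hbad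
  -- A vertex close to a sample point belongs to an octahedron centred within 97 + 2 / √2 + 0.03 <
  -- 99 of `x₀`, hence in `Fo`. The bound is about 3n per octahedron of `Fo`.
  have hB : ((I.filter bad).card : ℝ) ≤ Fo.card * 6 * (5 * (2 * 0.03 * n / 0.6 + 1)) := by
    refine card_samplePoint_near_vertex_le hP hd hnpos fun i hi => ?_
    rw [Finset.mem_filter] at hi
    obtain ⟨hiP, hin, hic⟩ := hmI i hi.1
    obtain ⟨S, hS, k, ε, hε, hdist⟩ := hi.2
    refine ⟨hiP, hin, S, (hmo S).2 ⟨hS, ?_⟩, k, ε, hε, hdist⟩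
    have h1 : dist (samplePoint cen bas n i) (cen i.1) ≤ 1 / √2 :=
      dist_le_of_mem_octahedron (edgePoint_mem (sampleParam_mem hin).1 (sampleParam_mem hin).2)
    have h2 : dist (octahedronVertex (cen S) (bas S) k ε) (cen S) ≤ 1 / √2 := by
      rw [octahedronVertex, dist_eq_norm, add_sub_cancel_left, norm_smul, Real.norm_eq_abs,
        (bas S).norm_eq_one, mul_one, abs_mul, abs_eq_abs.2 hε, abs_one, one_mul,
        abs_of_nonneg (by positivity)]
    have h3 := dist_triangle (cen S) (octahedronVertex (cen S) (bas S) k ε) x₀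
    have h4 := dist_triangle (octahedronVertex (cen S) (bas S) k ε) (samplePoint cen bas n i) x₀
    have h5 := dist_triangle (samplePoint cen bas n i) (cen i.1) x₀
    rw [dist_comm] at h2 hdist
    rw [mem_ball] at hic ⊢
    linarith [one_div_sqrt_two_lt]
  have hG : ((I.filter fun i => ¬ bad i).card : ℝ) ≤
      1 / (0.0005 * (4 * Real.pi / 3 * 0.00102 ^ 3)) * (5 * (2 * 0.00102 * n / 0.6 + 1) * u) +
      1 / (0.19 * (4 * Real.pi / 3 * 0.000002124 ^ 3)) *
        (5 * (2 * 0.000002124 * n / 0.6 + 1) * u) := by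
    have hpi := Real.pi_pos
    have hmG : ∀ i ∈ I.filter fun i => ¬ bad i,
        i.1 ∈ P ∧ i.2.2 < n ∧ cen i.1 ∈ ball x₀ (100 - 3) := fun i hi =>
      hmI i (Finset.mem_of_mem_filter _ hi)
    have hone := Finset.sum_le_sum fun i (hi : i ∈ I.filter fun i => ¬ bad i) =>
      one_le_uncovered_near_edgePoint hP hd (hmG i hi).1 (e := i.2.1)
        (sampleParam_mem (hmG i hi).2.1).1 (sampleParam_mem (hmG i hi).2.1).2 (by
          intro S hS k ε hε
          by_contra hcon
          exact (Finset.mem_filter.1 hi).2 ⟨S, hS, k, ε, hε, not_le.1 hcon⟩)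
    rw [Finset.sum_const, nsmul_eq_mul, mul_one, Finset.sum_add_distrib, ← Finset.mul_sum,
      ← Finset.mul_sum] at hone
    refine hone.trans ?_
    have e1 := sum_volume_real_hole_le hP hd hnpos (r := 0.00102) (by norm_num) (by norm_num) hmG
    have e2 := sum_volume_real_hole_le hP hd hnpos (r := 0.000002124) (by norm_num) (by norm_num)
      hmG
    simp only [samplePoint] at e1 e2
    gcongr
  have hsplit : (I.card : ℝ) = (I.filter bad).card + (I.filter fun i => ¬ bad i).card := by
    exact_mod_cast (Finset.card_filter_add_card_filter_not bad).symm
  have hpi := Real.pi_gt_d2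
  have hu0 : 0 ≤ u := measureReal_nonneg
  have hK : 4.18 ≤ 4 * Real.pi / 3 := by linarith
  set K := 4 * Real.pi / 3 with hKdef
  have hc1 : 1 / (0.0005 * (K * 0.00102 ^ 3)) ≤ 1 / (0.0005 * (4.18 * 0.00102 ^ 3)) := by gcongr
  have hc2 : 1 / (0.19 * (K * 0.000002124 ^ 3)) ≤ 1 / (0.19 * (4.18 * 0.000002124 ^ 3)) := by
    gcongr
  -- The constant comes almost entirely from the tiny holes, the second alternative.
  have hG' : ((I.filter fun i => ¬ bad i).card : ℝ) ≤ 4.68e20 * u := by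
    rw [hnr] at hG
    refine hG.trans ((add_le_add (mul_le_mul_of_nonneg_right hc1 (by positivity))
      (mul_le_mul_of_nonneg_right hc2 (by positivity))).trans ?_)
    have : (1 / (0.0005 * (4.18 * 0.00102 ^ 3)) * (5 * (2 * 0.00102 * 10 ^ 8 / 0.6 + 1)) +
      1 / (0.19 * (4.18 * 0.000002124 ^ 3)) * (5 * (2 * 0.000002124 * 10 ^ 8 / 0.6 + 1)) : ℝ) ≤
        4.68e20 := by norm_num
    calc _ = (1 / (0.0005 * (4.18 * 0.00102 ^ 3)) * (5 * (2 * 0.00102 * 10 ^ 8 / 0.6 + 1)) +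
      1 / (0.19 * (4.18 * 0.000002124 ^ 3)) * (5 * (2 * 0.000002124 * 10 ^ 8 / 0.6 + 1)) : ℝ) *
        u := by ring
      _ ≤ _ := by gcongr
  rw [hcardI] at hsplit
  rw [hnr] at hB hsplit
  have hV : √2 / 3 < 0.4715 := by linarith [sqrt_two_bounds.2]
  have hV0 : 0 < √2 / 3 := by positivity
  set v := √2 / 3 with hv
  -- Roughly 12 · |`Fi`| ≤ 3 · |`Fo`| + a multiple of `u`. Were `u` tiny, |`Fi`| and |`Fo`| would
  -- nearly agree, their volumes differing at most by a factor of about (100 / 96) ^ 3.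
  have h1 : (Fi.card : ℝ) * v * (12 * 10 ^ 8) ≤
      Fo.card * v * (6 * (5 * (2 * 0.03 * 10 ^ 8 / 0.6 + 1))) + 4.68e20 * (v * u) := by
    have : (Fi.card : ℝ) * (12 * 10 ^ 8) ≤
      Fo.card * 6 * (5 * (2 * 0.03 * 10 ^ 8 / 0.6 + 1)) + 4.68e20 * u := by linarith
    nlinarith [mul_le_mul_of_nonneg_left this hV0.le]
  have h2 : v * u ≤ 0.4715 * u := by gcongr
  norm_num at h1 hNi hNo ⊢
  linarith

/-! ### Averaging and the density bound. -/

/-- If every ball of radius `d` has an uncovered part of volume at least `m`, then averaging bounds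
the uncovered part of a large ball from below. -/
theorem mul_volume_ball_le_of_forall_ball {U : Set E3} (hU : MeasurableSet U) {d m : ℝ}
    (hd : 0 ≤ d) (h : ∀ x, m ≤ volume.real (ball x d \ U)) {R : ℝ} (hR : d ≤ R) :
    m * (R - d) ^ 3 ≤ d ^ 3 * volume.real (ball 0 R \ U) := by
  have hpi := Real.pi_pos
  set A := ball (0 : E3) R \ U with hA
  have hAm : MeasurableSet A := measurableSet_ball.diff hU
  have hAfin : volume A ≠ ⊤ := measure_ne_top_of_subset sdiff_subset measure_ball_lt_top.ne
  -- Pairs of a centre `x` and an uncovered point `y` with `dist x y < d`; its measure is estimated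
  -- by slicing in either variable.
  set S : Set (E3 × E3) := {p | p.1 ∈ ball (0 : E3) (R - d)} ∩ {p | p.2 ∈ A} ∩ {p | dist p.1 p.2 < d}
    with hS
  have hSm : MeasurableSet S :=
    ((measurable_fst measurableSet_ball).inter (measurable_snd hAm)).inter
      (measurableSet_lt (measurable_fst.dist measurable_snd) measurable_const)
  have hmem : ∀ x y, (x, y) ∈ S ↔ (dist x 0 < R - d ∧ y ∈ A) ∧ dist x y < d := by
    intro x y; simp [hS]
  have hlow : ENNReal.ofReal m * volume (ball (0 : E3) (R - d)) ≤
      (volume.prod volume : Measure (E3 × E3)) S := by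
    rw [Measure.prod_apply hSm, ← setLIntegral_const]
    refine (setLIntegral_mono' measurableSet_ball fun x hx => ?_).trans (setLIntegral_le_lintegral _ _)
    refine (ENNReal.ofReal_le_of_le_toReal (h x)).trans (measure_mono ?_)
    intro y hy
    rw [mem_preimage, hmem]
    have hyx := mem_ball.1 hy.1
    have hx0 := mem_ball.1 hx
    refine ⟨⟨hx0, mem_ball.2 ?_, hy.2⟩, by rwa [dist_comm]⟩
    linarith [dist_triangle y x 0]
  have hup : (volume.prod volume : Measure (E3 × E3)) S ≤
      ENNReal.ofReal (4 * Real.pi / 3 * d ^ 3) * volume A := by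
    rw [Measure.prod_apply_symm hSm, ← setLIntegral_const, ← lintegral_indicator hAm]
    refine lintegral_mono fun y => ?_
    by_cases hy : y ∈ A
    · rw [indicator_of_mem hy, ← volume_real_ball y hd, ofReal_measureReal measure_ball_lt_top.ne]
      refine measure_mono fun x hx => ?_
      rw [mem_preimage, hmem] at hx
      exact mem_ball.2 hx.2
    · rw [indicator_of_notMem hy, nonpos_iff_eq_zero, ← nonpos_iff_eq_zero,
        ← measure_empty (μ := (volume : Measure E3))]
      refine measure_mono fun x hx => ?_
      rw [mem_preimage, hmem] at hx
      exact hy hx.1.2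
  have key := hlow.trans hup
  rcases le_or_gt m 0 with hm | hm
  · have h1 : 0 ≤ (R - d) ^ 3 := pow_nonneg (by linarith) 3
    have h2 : 0 ≤ d ^ 3 * volume.real A := by positivity
    nlinarith
  rw [← ofReal_measureReal measure_ball_lt_top.ne, ← ofReal_measureReal hAfin,
    ← ENNReal.ofReal_mul hm.le, ← ENNReal.ofReal_mul (by positivity),
    ENNReal.ofReal_le_ofReal_iff (by positivity), volume_real_ball _ (by linarith)] at key
  have h3 : 4 * Real.pi / 3 * (m * (R - d) ^ 3) ≤
      4 * Real.pi / 3 * (d ^ 3 * volume.real A) := by linarith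
  exact le_of_mul_le_mul_left h3 (by positivity)

theorem IsPacking.upperDensity_le (hP : IsPacking P) :
    upperDensity P ≤ ENNReal.ofReal (1 - 1.43e-12) := by
  have hpi := Real.pi_pos
  have hex : ∀ T : Set E3, ∃ (c : E3) (b : OrthonormalBasis (Fin 3) ℝ E3),
      T ∈ P → T = OctahedronPacking.octahedron c b := by
    intro T
    by_cases hT : T ∈ P
    · obtain ⟨c, b, h⟩ := (hP.octahedron T hT).exists_eq_octahedron
      exact ⟨c, b, fun _ => h⟩
    · exact ⟨0, EuclideanSpace.basisFun _ _, fun h => absurd h hT⟩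
  choose cen bas hoct using hex
  have hU : MeasurableSet (⋃₀ P) := measurableSet_sUnion_packing hoct hP.nonoverlapping
  refine Filter.limsup_le_of_le ?_ ?_
  · exact Filter.isCobounded_le_of_bot
  filter_upwards [Filter.eventually_ge_atTop (10000 : ℝ)] with R hR
  have hhole := mul_volume_ball_le_of_forall_ball hU (d := 100) (by norm_num)
    (uncovered_ball_hundred hoct hP.nonoverlapping) (by linarith : (100 : ℝ) ≤ R)
  have hpos : 0 < volume (ball (0 : E3) R) := measure_ball_pos _ _ (by linarith)
  refine ENNReal.div_le_of_le_mul ?_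
  have hcov : volume.real (⋃₀ P ∩ ball (0 : E3) R) =
      volume.real (ball (0 : E3) R) - volume.real (ball (0 : E3) R \ ⋃₀ P) := by
    rw [← measureReal_inter_add_sdiff (μ := volume) (s := ball (0 : E3) R) hU measure_ball_lt_top.ne,
      inter_comm]
    ring
  rw [← ofReal_measureReal (volume_inter_ball_ne_top _ _ _), hcov,
    ← ofReal_measureReal (measure_ball_lt_top (x := (0 : E3)) (r := R)).ne,
    ← ENNReal.ofReal_mul (by norm_num)]
  refine ENNReal.ofReal_le_ofReal ?_
  rw [volume_real_ball _ (by linarith)]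
  -- For `R ≥ 10000` the boundary loss is a factor 0.99 ^ 3, and 1.5e-12 · 0.99 ^ 3 > 1.43e-12.
  have hcube : (0.99 * R) ^ 3 ≤ (R - 100) ^ 3 := by gcongr; linarith
  have hR3 : 0 < R ^ 3 := by positivity
  have hcube' := mul_le_mul_of_nonneg_left hcube hpi.le
  have hpR : 0 < Real.pi * R ^ 3 := by positivity
  rw [mul_pow] at hcube'
  norm_num at hhole hcube' ⊢
  nlinarith

end
end OctahedronPacking

/-- The packing density of regular octahedra is at most `1 - δ_o`, where
`δ_o = 1.42… × 10⁻¹²` is the explicit constant `deltaO`. -/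
theorem mainTheorem4 :
    ((1.42e-12 : ℝ) ≤ OctahedronPacking.deltaO ∧ OctahedronPacking.deltaO < (1.43e-12 : ℝ)) ∧
    OctahedronPacking.packingDensity ≤ ENNReal.ofReal (1 - OctahedronPacking.deltaO) := by
  refine ⟨OctahedronPacking.deltaO_bounds, iSup₂_le fun P hP => hP.upperDensity_le.trans ?_⟩
  exact ENNReal.ofReal_le_ofReal (by linarith [OctahedronPacking.deltaO_bounds.2])
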